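/- For $k\in\{1,2,\dots\}\cup\{\infty\}$ and a smooth surface $S$ (a nonempty Hausdorff smooth $2$-manifold without boundary), a $C^k$ curve on $S$ is a connected, properly embedded one-dimensional $C^k$ submanifold of $S$ (that is, embedded and closed as a subset); it is a simple closed $C^k$ curve if it is moreover compact. Let $\mathrm{Homeo}^k(S)$ be the group of homeomorphisms $f$ of $S$ such that both $f$ and $f^{-1}$ map simple closed $C^k$ curves to simple closed $C^k$ curves. Define $m:\mathbb{R}^2\to\mathbb{R}$ by $m(x,y)=\dfrac{x}{\sqrt{x^2+y^2}}+2$ for $(x,y)\neq(0,0)$ and $m(0,0)=2$, and define $M:\mathbb{R}^2\to\mathbb{R}^2$ by $M(x,y)=(x\,m(x,y),\,y\,m(x,y))$. Then: 1. $M$ is a homeomorphism of $\mathbb{R}^2$, and $M$ and $M^{-1}$ send $C^1$ curves to $C^1$ curves (all properly embedded ones, compact or not). In particular $M\in\mathrm{Homeo}^1(\mathbb{R}^2)$. 2. The parabola $y=x^2$ is a $C^\infty$ curve. The parametrization $t\mapsto M(t,t^2)$ of its image is $C^\infty$ with nonzero derivative at every $t\neq0$, and the curvature of the image jumps at the origin: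 it tends to $2$ as $t\to0^-$ and to $\tfrac23$ as $t\to0^+$. The image of the parabola is not a $C^k$ curve for any $2\le k\le\infty$. 3. $M\notin\mathrm{Homeo}^k(\mathbb{R}^2)$ for every $2\le k\le\infty$. 4. For every smooth surface $S$ and every $2\le k\le\infty$, $\mathrm{Homeo}^1(S)\not\subset\mathrm{Homeo}^k(S)$. The same holds if, in the definition of these groups, "simple closed $C^k$ curves" is replaced by "$C^k$ curves". -/

import Mathlib

open Set Filter Topology
open scoped Manifold ContDiff

noncomputable section

/-- The Euclidean plane `ℝ²`. -/
abbrev Plane : Type := EuclideanSpace ℝ (Fin 2)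

section Curves

variable {S : Type*} [TopologicalSpace S] [ChartedSpace Plane S]

/-- `C` is an embedded one-dimensional `C^k` submanifold of the surface `S`: around each of its
points there is a `C^k` chart of `S` that carries `C` to the horizontal axis. -/
def IsCkOneSubmanifold (k : ℕ∞) (C : Set S) : Prop :=
  ∀ p ∈ C, ∃ φ ∈ IsManifold.maximalAtlas (𝓡 2) (k : WithTop ℕ∞) S,
    p ∈ φ.source ∧ ∀ q ∈ φ.source, q ∈ C ↔ φ q 1 = 0

/-- `C` is a `C^k` curve on `S`: a connected properly embedded (that is, embedded and closed as a
subset) one-dimensional `C^k` submanifold. -/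
def IsCkCurve (k : ℕ∞) (C : Set S) : Prop :=
  IsClosed C ∧ IsConnected C ∧ IsCkOneSubmanifold k C

/-- `C` is a simple closed `C^k` curve on `S`: a compact `C^k` curve. -/
def IsSimpleClosedCkCurve (k : ℕ∞) (C : Set S) : Prop :=
  IsCompact C ∧ IsCkCurve k C

end Curves

section Groups

/-- The subgroup of the homeomorphisms `f` of `X` such that both `f` and `f⁻¹` map members of the
family `P` of subsets of `X` to members of `P`. -/
def homeoPreserving {X : Type*} [TopologicalSpace X] (P : Set X → Prop) : Subgroup (X ≃ₜ X) where
  carrier := {f | (∀ C, P C → P (f '' C)) ∧ ∀ C, P C → P (f.symm '' C)}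
  one_mem' := by
    refine ⟨fun C hC => ?_, fun C hC => ?_⟩
    · have h : ((1 : X ≃ₜ X) '' C) = C := image_id C
      rwa [h]
    · have h : ((1 : X ≃ₜ X).symm '' C) = C := image_id C
      rwa [h]
  mul_mem' := by
    rintro f g ⟨hf, hf'⟩ ⟨hg, hg'⟩
    refine ⟨fun C hC => ?_, fun C hC => ?_⟩
    · have h : ((f * g : X ≃ₜ X) '' C) = f '' (g '' C) := image_comp f g C
      rw [h]
      exact hf _ (hg _ hC)
    · have h : ((f * g : X ≃ₜ X).symm '' C) = g.symm '' (f.symm '' C) :=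
        image_comp g.symm f.symm C
      rw [h]
      exact hg' _ (hf' _ hC)
  inv_mem' := by
    rintro f ⟨hf, hf'⟩
    exact ⟨hf', hf⟩

variable (k : ℕ∞) (S : Type*) [TopologicalSpace S] [ChartedSpace Plane S]

/-- `Homeo^k(S)`: the homeomorphisms `f` of `S` such that both `f` and `f⁻¹` map simple closed
`C^k` curves to simple closed `C^k` curves. -/
def HomeoCk : Subgroup (S ≃ₜ S) := homeoPreserving (IsSimpleClosedCkCurve k)

/-- The variant of `Homeo^k(S)` in which the curves are all properly embedded ones, compact or
not. If `S` is compact, it is the same group. -/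
def ProperHomeoCk : Subgroup (S ≃ₜ S) := homeoPreserving (IsCkCurve k)

end Groups

/-- The factor `m(x, y)`, which is `x / √(x² + y²) + 2` off the origin and `2` at the origin. -/
def mFactor (p : Plane) : ℝ :=
  open Classical in if p = 0 then 2 else p 0 / √(p 0 ^ 2 + p 1 ^ 2) + 2

/-- The map `M(x, y) = (x m(x, y), y m(x, y))` of the plane. -/
def mMap (p : Plane) : Plane := !₂[p 0 * mFactor p, p 1 * mFactor p]

/-- The parabola `y = x²`. -/
def parabola : Set Plane := {p | p 1 = p 0 ^ 2}

/-- The parametrization `t ↦ M(t, t²)` of the image of the parabola `y = x²` under `M`. -/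
def imageParam (t : ℝ) : Plane := mMap !₂[t, t ^ 2]

/-- The signed curvature `(x' y'' - y' x'') / (x'² + y'²)^(3/2)` of a plane curve `γ = (x, y)`
at `t`. It is meaningful where `γ` is twice differentiable with `γ' ≠ 0`. -/
def signedCurvature (γ : ℝ → Plane) (t : ℝ) : ℝ :=
  (deriv γ t 0 * deriv (deriv γ) t 1 - deriv γ t 1 * deriv (deriv γ) t 0) / ‖deriv γ t‖ ^ 3

end

/-!
The map `M` multiplies each vector `p` by a positive factor `h p` that depends only on the direction
of `p`, so it preserves rays and is a `C^1` diffeomorphism off the origin. Let `g` be a `C^1`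
defining function of a curve through the origin. Then `p ↦ g (h p • p) / h p` defines the preimage
of the curve. Off the origin its derivative differs from that of `g` at `w = h p • p` by a bounded
multiple of the Euler defect `g' w w - g w = o(‖w‖)` times `h' p = O(‖p‖⁻¹)`, so it extends
continuously by `g' 0`. Hence `M` and its inverse preserve `C^1` curves.

The factor has different limits along the two halves of a curve tangent to the horizontal axis, and
dilation by a factor divides the curvature by it. So the image of a curve with nonzero curvature at
the origin, such as the parabola or a tangent circle, has a jump of curvature there and is not
`C^2`.

On an arbitrary surface, replace the factor by `1 + χ * cosArg` with a small bump function `χ`, so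
that the map is the identity off a small disc, and transplant it by a chart centered at some point.
-/

/-- `C` is a one-dimensional `C^k` submanifold near the point `p` of the surface `S`: the condition
that `IsCkOneSubmanifold` imposes at `p`. -/
def IsCkOneSubmanifoldAt {S : Type*} [TopologicalSpace S] [ChartedSpace Plane S]
    (k : ℕ∞) (C : Set S) (p : S) : Prop :=
  ∃ φ ∈ IsManifold.maximalAtlas (𝓡 2) (k : WithTop ℕ∞) S,
    p ∈ φ.source ∧ ∀ q ∈ φ.source, q ∈ C ↔ φ q 1 = 0

section Charts

variable {E : Type*} [NormedAddCommGroup E] [NormedSpace ℝ E] {S : Type*} [TopologicalSpace S]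
  [ChartedSpace E S] {n : WithTop ℕ∞} [IsManifold 𝓘(ℝ, E) n S]

theorem trans_mem_maximalAtlas {ψ : OpenPartialHomeomorph S E} {φ : OpenPartialHomeomorph E E}
    (hψ : ψ ∈ IsManifold.maximalAtlas 𝓘(ℝ, E) n S)
    (hφ : φ ∈ IsManifold.maximalAtlas 𝓘(ℝ, E) n E) :
    ψ.trans φ ∈ IsManifold.maximalAtlas 𝓘(ℝ, E) n S := by
  rw [IsManifold.mem_maximalAtlas_iff_contMDiffOn] at *
  exact ⟨hφ.1.comp (hψ.1.mono (by simp)) (by simp), hψ.2.comp (hφ.2.mono (by simp)) (by simp)⟩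

theorem exists_mem_maximalAtlas_apply_eq_zero (x : S) :
    ∃ ψ ∈ IsManifold.maximalAtlas 𝓘(ℝ, E) n S, x ∈ ψ.source ∧ ψ x = 0 := by
  let τ : E ≃ₜ E := Homeomorph.subRight (chartAt E x x)
  have hτ : τ.toOpenPartialHomeomorph ∈ IsManifold.maximalAtlas 𝓘(ℝ, E) n E := by
    rw [IsManifold.mem_maximalAtlas_iff_contMDiffOn, contMDiffOn_iff_contDiffOn,
      contMDiffOn_iff_contDiffOn]
    exact ⟨(contDiff_id.sub contDiff_const).contDiffOn, (contDiff_id.add contDiff_const).contDiffOn⟩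
  exact ⟨(chartAt E x).trans τ.toOpenPartialHomeomorph,
    trans_mem_maximalAtlas (IsManifold.chart_mem_maximalAtlas x) hτ, by simp, by simp [τ]⟩

end Charts

section SubmanifoldGerms

variable {S : Type*} [TopologicalSpace S] [ChartedSpace Plane S] {k : ℕ∞} {C C' : Set S} {p : S}

theorem IsCkOneSubmanifoldAt.mono {j : ℕ∞} (h : IsCkOneSubmanifoldAt k C p) (hj : j ≤ k) :
    IsCkOneSubmanifoldAt j C p := by
  obtain ⟨φ, hφ, h⟩ := h
  exact ⟨φ, IsManifold.maximalAtlas_subset_of_le (mod_cast hj) hφ, h⟩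

theorem IsCkOneSubmanifoldAt.congr (h : IsCkOneSubmanifoldAt k C p)
    (hC : ∀ᶠ q in 𝓝 p, q ∈ C ↔ q ∈ C') : IsCkOneSubmanifoldAt k C' p := by
  obtain ⟨φ, hφ, hp, h⟩ := h
  obtain ⟨s, hs, hso, hps⟩ := eventually_nhds_iff.1 hC
  refine ⟨φ.restr s, restr_mem_maximalAtlas _ hφ hso, ?_, fun q hq => ?_⟩
  · simpa [hso.interior_eq] using ⟨hp, hps⟩
  · rw [OpenPartialHomeomorph.restr_source, hso.interior_eq] at hq
    exact (hs q hq.2).symm.trans (h q hq.1)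

theorem isCkOneSubmanifoldAt_symm_preimage_iff [IsManifold (𝓡 2) k S]
    {ψ : OpenPartialHomeomorph S Plane}
    (hψ : ψ ∈ IsManifold.maximalAtlas (𝓡 2) (k : WithTop ℕ∞) S) (hp : p ∈ ψ.source) :
    IsCkOneSubmanifoldAt k (ψ.symm ⁻¹' C) (ψ p) ↔ IsCkOneSubmanifoldAt k C p := by
  constructor
  · rintro ⟨φ, hφ, hpφ, h⟩
    refine ⟨ψ.trans φ, trans_mem_maximalAtlas hψ hφ, by simp [hp, hpφ], fun q hq => ?_⟩
    simp only [OpenPartialHomeomorph.trans_source, mem_inter_iff, mem_preimage] at hq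
    simpa [hq.1] using h _ hq.2
  · rintro ⟨φ, hφ, hpφ, h⟩
    refine ⟨ψ.symm.trans φ, StructureGroupoid.mem_maximalAtlas_of_mem_groupoid _
      (IsManifold.compatible_of_mem_maximalAtlas hψ hφ), by simp [hp, hpφ], fun q hq => ?_⟩
    simp only [OpenPartialHomeomorph.trans_source, mem_inter_iff, mem_preimage] at hq
    exact h _ hq.2

theorem isCkOneSubmanifoldAt_symm_image_iff [IsManifold (𝓡 2) k S]
    {ψ : OpenPartialHomeomorph S Plane}
    (hψ : ψ ∈ IsManifold.maximalAtlas (𝓡 2) (k : WithTop ℕ∞) S) {D : Set Plane} {q : Plane}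
    (hD : D ⊆ ψ.target) (hq : q ∈ ψ.target) :
    IsCkOneSubmanifoldAt k (ψ.symm '' D) (ψ.symm q) ↔ IsCkOneSubmanifoldAt k D q := by
  have mem_iff : ∀ᶠ x in 𝓝 q, x ∈ ψ.symm ⁻¹' (ψ.symm '' D) ↔ x ∈ D := by
    filter_upwards [ψ.open_target.mem_nhds hq] with x hx
    exact ψ.symm.injOn.mem_image_iff hD hx
  rw [← isCkOneSubmanifoldAt_symm_preimage_iff hψ (ψ.map_target hq), ψ.right_inv hq]
  exact ⟨fun h => h.congr mem_iff, fun h => h.congr (mem_iff.mono fun _ => Iff.symm)⟩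

end SubmanifoldGerms

section InverseFunction

variable {E : Type*} [NormedAddCommGroup E] [NormedSpace ℝ E] [CompleteSpace E]

theorem eventually_exists_hasFDerivAt_equiv {G : E → E} {q : E} {e : E ≃L[ℝ] E}
    (hG : ContDiffAt ℝ 1 G q) (hG' : HasFDerivAt G (e : E →L[ℝ] E) q) :
    ∀ᶠ p in 𝓝 q, ∃ e' : E ≃L[ℝ] E, HasFDerivAt G (e' : E →L[ℝ] E) p := by
  have invertible : ∀ᶠ p in 𝓝 q, fderiv ℝ G p ∈ range ((↑) : (E ≃L[ℝ] E) → E →L[ℝ] E) :=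
    (hG.continuousAt_fderiv one_ne_zero).eventually (hG'.fderiv ▸ e.nhds)
  filter_upwards [invertible, hG.eventually (by simp)] with p ⟨e', he'⟩ hp
  exact ⟨e', he' ▸ (hp.differentiableAt one_ne_zero).hasFDerivAt⟩

theorem exists_mem_maximalAtlas_of_hasFDerivAt_equiv {k : WithTop ℕ∞} (hk : k ≠ 0) {G : E → E}
    {q : E} {e : E ≃L[ℝ] E} (hG : ∀ᶠ p in 𝓝 q, ContDiffAt ℝ k G p)
    (hG' : HasFDerivAt G (e : E →L[ℝ] E) q) :
    ∃ Φ ∈ IsManifold.maximalAtlas 𝓘(ℝ, E) k E, q ∈ Φ.source ∧ ⇑Φ = G := by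
  have hq := hG.self_of_nhds
  have regular := hG.and (eventually_exists_hasFDerivAt_equiv
    (hq.of_le (ENat.one_le_iff_ne_zero_withTop.2 hk)) hG')
  obtain ⟨V, hV, hVo, hqV⟩ := eventually_nhds_iff.1 regular
  let Φ := (hq.toOpenPartialHomeomorph G hG' hk).restr V
  have source_subset : Φ.source ⊆ V := fun x hx => by
    rw [OpenPartialHomeomorph.restr_source, hVo.interior_eq] at hx
    exact hx.2
  refine ⟨Φ, ?_, ?_, rfl⟩
  · rw [IsManifold.mem_maximalAtlas_iff_contMDiffOn, contMDiffOn_iff_contDiffOn,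
      contMDiffOn_iff_contDiffOn]
    refine ⟨fun x hx => (hV x (source_subset hx)).1.contDiffWithinAt, fun y hy => ?_⟩
    obtain ⟨hGy, e', he'⟩ := hV _ (source_subset (Φ.map_target hy))
    exact (Φ.contDiffAt_symm hy he' hGy).contDiffWithinAt
  · rw [OpenPartialHomeomorph.restr_source, hVo.interior_eq]
    exact ⟨hq.mem_toOpenPartialHomeomorph_source hG' hk, hqV⟩

end InverseFunction

section DefiningFunctions

/-- `g` defines the plane set `D` near `q` as the zero set of a `C^k` submersion to the line. The
point `q` need not lie in `D`. -/
def IsLocalDefiningFunction (k : ℕ∞) (g : Plane → ℝ) (D : Set Plane) (q : Plane) : Prop :=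
  fderiv ℝ g q ≠ 0 ∧ ∀ᶠ p in 𝓝 q, ContDiffAt ℝ k g p ∧ (p ∈ D ↔ g p = 0)

theorem exists_continuousLinearEquiv_apply_one_eq {ℓ : Plane →L[ℝ] ℝ} (hℓ : ℓ ≠ 0) :
    ∃ e : Plane ≃L[ℝ] Plane, ∀ v, e v 1 = ℓ v := by
  set a := ℓ (EuclideanSpace.single 0 1)
  set b := ℓ (EuclideanSpace.single 1 1)
  have ℓ_apply (v : Plane) : ℓ v = a * v 0 + b * v 1 := by
    conv_lhs => rw [← (EuclideanSpace.basisFun (Fin 2) ℝ).sum_repr v]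
    simp [Fin.sum_univ_two, a, b, mul_comm]
  have hab : a ^ 2 + b ^ 2 ≠ 0 := fun h => hℓ <| by
    obtain ⟨ha, hb⟩ : a = 0 ∧ b = 0 := by constructor <;> nlinarith
    ext v
    simp [ℓ_apply, ha, hb]
  let A : Plane →ₗ[ℝ] Plane :=
    { toFun := fun v => !₂[b * v 0 - a * v 1, ℓ v]
      map_add' := fun v w => by
        ext i
        fin_cases i
        · change b * (v 0 + w 0) - a * (v 1 + w 1) = (b * v 0 - a * v 1) + (b * w 0 - a * w 1)
          ring
        · exact map_add ℓ v w
      map_smul' := fun s v => by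
        ext i
        fin_cases i
        · change b * (s * v 0) - a * (s * v 1) = s * (b * v 0 - a * v 1)
          ring
        · exact map_smul ℓ s v }
  have injective : Function.Injective A := (injective_iff_map_eq_zero _).2 fun v hv => by
    have h0 : b * v 0 - a * v 1 = 0 := congr($hv 0)
    have h1 : a * v 0 + b * v 1 = 0 := (ℓ_apply v).symm.trans congr($hv 1)
    have hv0 : (a ^ 2 + b ^ 2) * v 0 = 0 := by linear_combination b * h0 + a * h1
    have hv1 : (a ^ 2 + b ^ 2) * v 1 = 0 := by linear_combination b * h1 - a * h0
    ext i
    fin_cases i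
    exacts [(mul_eq_zero.1 hv0).resolve_left hab, (mul_eq_zero.1 hv1).resolve_left hab]
  exact ⟨(LinearEquiv.ofInjectiveEndo A injective).toContinuousLinearEquiv, fun v => rfl⟩

theorem IsLocalDefiningFunction.isCkOneSubmanifoldAt {k : ℕ∞} (hk : k ≠ 0) {g : Plane → ℝ}
    {D : Set Plane} {q : Plane} (hg : IsLocalDefiningFunction k g D q) :
    IsCkOneSubmanifoldAt k D q := by
  obtain ⟨hg', hgD⟩ := hg
  have hk' : (k : WithTop ℕ∞) ≠ 0 := mod_cast hk
  obtain ⟨e, he⟩ := exists_continuousLinearEquiv_apply_one_eq hg'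
  let v : Plane := EuclideanSpace.single 1 1
  let G : Plane → Plane := fun p => e p + (g p - fderiv ℝ g q p) • v
  have G_apply_one (p : Plane) : G p 1 = g p := by simp [G, v, he]
  have contDiffAt_G : ∀ᶠ p in 𝓝 q, ContDiffAt ℝ k G p := hgD.mono fun p hp =>
    e.contDiff.contDiffAt.add ((hp.1.sub (fderiv ℝ g q).contDiff.contDiffAt).smul contDiffAt_const)
  have hasFDerivAt_G : HasFDerivAt G (e : Plane →L[ℝ] Plane) q := by
    have h := (hgD.self_of_nhds.1.differentiableAt hk').hasFDerivAt
    have hG := e.hasFDerivAt.fun_add ((h.fun_sub (fderiv ℝ g q).hasFDerivAt).smul_const v)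
    rwa [sub_self, ContinuousLinearMap.zero_smulRight, add_zero] at hG
  obtain ⟨Φ, hΦ, hq, coe_Φ⟩ :=
    exists_mem_maximalAtlas_of_hasFDerivAt_equiv hk' contDiffAt_G hasFDerivAt_G
  have zeroSet : IsCkOneSubmanifoldAt k {p | g p = 0} q :=
    ⟨Φ, hΦ, hq, fun p _ => by rw [coe_Φ, G_apply_one, mem_ofPred_eq]⟩
  exact zeroSet.congr (hgD.mono fun p hp => hp.2.symm)

theorem IsCkOneSubmanifoldAt.exists_isLocalDefiningFunction {k : ℕ∞} (hk : k ≠ 0) {D : Set Plane}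
    {q : Plane} (h : IsCkOneSubmanifoldAt k D q) : ∃ g, IsLocalDefiningFunction k g D q := by
  obtain ⟨φ, hφ, hq, h⟩ := h
  rw [IsManifold.mem_maximalAtlas_iff_contMDiffOn, contMDiffOn_iff_contDiffOn,
    contMDiffOn_iff_contDiffOn] at hφ
  have hk' : (k : WithTop ℕ∞) ≠ 0 := mod_cast hk
  have source_mem := φ.open_source.mem_nhds hq
  let π : Plane →L[ℝ] ℝ := EuclideanSpace.proj 1
  have contDiffAt_g {p : Plane} (hp : p ∈ φ.source) : ContDiffAt ℝ k (fun p => π (φ p)) p :=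
    π.contDiff.contDiffAt.comp p (hφ.1.contDiffAt (φ.open_source.mem_nhds hp))
  refine ⟨fun p => π (φ p), fun h0 => ?_, ?_⟩
  · have hg : HasFDerivAt (fun p => π (φ p)) (0 : Plane →L[ℝ] ℝ) (φ.symm (φ q)) := by
      rw [φ.left_inv hq, ← h0]
      exact ((contDiffAt_g hq).differentiableAt hk').hasFDerivAt
    have target_mem := φ.open_target.mem_nhds (φ.map_source hq)
    have hφ' := ((hφ.2.contDiffAt target_mem).differentiableAt hk').hasFDerivAt
    have hπ : HasFDerivAt (fun y => π (φ (φ.symm y))) π (φ q) :=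
      π.hasFDerivAt.congr_of_eventuallyEq <| by
        filter_upwards [target_mem] with y hy
        rw [φ.right_inv hy]
    have π_eq_zero : π = 0 := hπ.unique (hg.comp (φ q) hφ')
    simpa [π] using congr($π_eq_zero (EuclideanSpace.single 1 1))
  · filter_upwards [source_mem] with p hp
    exact ⟨contDiffAt_g hp, h p hp⟩

end DefiningFunctions

section ExtensionOverPoint

open Asymptotics

variable {E F : Type*} [NormedAddCommGroup E] [NormedSpace ℝ E]
  [NormedAddCommGroup F] [NormedSpace ℝ F]

theorem contDiffAt_one_of_tendsto_fderiv {f : E → F} {a : E} {ℓ : E →L[ℝ] F}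
    (hf : ∀ᶠ p in 𝓝[≠] a, DifferentiableAt ℝ f p ∧ ContinuousAt (fderiv ℝ f) p)
    (ha : HasFDerivAt f ℓ a) (hlim : Tendsto (fderiv ℝ f) (𝓝[≠] a) (𝓝 ℓ)) :
    ContDiffAt ℝ 1 f a := by
  obtain ⟨u, hu, hf⟩ := (eventually_nhdsWithin_iff.1 hf).exists_mem
  refine contDiffAt_one_iff.2 ⟨fderiv ℝ f, u, hu, fun p hp => ContinuousAt.continuousWithinAt ?_,
    fun p hp => ?_⟩ <;> rcases eq_or_ne p a with rfl | hpa
  · rwa [continuousAt_iff_punctured_nhds, ha.fderiv]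
  · exact (hf p hp hpa).2
  · rwa [ha.fderiv]
  · exact (hf p hp hpa).1.hasFDerivAt

variable {g h : E → ℝ}

theorem fderiv_apply_self_sub_isLittleO (hg : ContDiffAt ℝ 1 g 0) (hg0 : g 0 = 0) :
    (fun w => fderiv ℝ g w w - g w) =o[𝓝 0] (fun w : E => w) := by
  have h1 : (fun w => (fderiv ℝ g w - fderiv ℝ g 0) w) =o[𝓝 0] (fun w : E => w) := by
    refine isLittleO_iff.2 fun c hc => ?_
    filter_upwards [Metric.tendsto_nhds.1 (hg.continuousAt_fderiv one_ne_zero) c hc] with w hw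
    rw [dist_eq_norm] at hw
    exact (fderiv ℝ g w - fderiv ℝ g 0).le_of_opNorm_le hw.le w
  have h2 : (fun w => g w - fderiv ℝ g 0 w) =o[𝓝 0] (fun w : E => w) := by
    simpa [hg0] using (hg.differentiableAt one_ne_zero).hasFDerivAt.isLittleO
  simpa using h1.sub h2

theorem smul_self_isBigO (hb : h =O[𝓝 0] (1 : E → ℝ)) :
    (fun p => h p • p) =O[𝓝 0] (fun p : E => p) := by
  simpa using hb.smul (isBigO_refl (fun p : E => p) (𝓝 0))

theorem smul_self_tendsto_zero (hb : h =O[𝓝 0] (1 : E → ℝ)) :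
    Tendsto (fun p => h p • p) (𝓝 (0 : E)) (𝓝 0) :=
  (smul_self_isBigO hb).trans_tendsto tendsto_id

theorem hasFDerivAt_comp_smul_div (hg : DifferentiableAt ℝ g 0) (hg0 : g 0 = 0)
    (hh : ∀ᶠ p in 𝓝 0, h p ≠ 0) (hb : h =O[𝓝 0] (1 : E → ℝ)) (hc : h⁻¹ =O[𝓝 0] (1 : E → ℝ)) :
    HasFDerivAt (fun p => g (h p • p) / h p) (fderiv ℝ g 0) 0 := by
  have remainder : (fun w => g w - fderiv ℝ g 0 w) =o[𝓝 0] (fun w : E => w) := by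
    simpa [hg0] using hg.hasFDerivAt.isLittleO
  have remainder_div := hc.mul_isLittleO
    ((remainder.comp_tendsto (smul_self_tendsto_zero hb)).trans_isBigO
      (smul_self_isBigO hb)).norm_right
  refine .of_isLittleO (.of_norm_right (remainder_div.congr' ?_ (.of_forall fun p => ?_)))
  · filter_upwards [hh] with p hp
    simp only [Pi.inv_apply, Function.comp_apply, map_smul, smul_eq_mul, smul_zero, hg0, zero_div,
      sub_zero]
    field_simp
  · simp

theorem fderiv_comp_smul_div {p : E} (hg : DifferentiableAt ℝ g (h p • p))
    (hh : DifferentiableAt ℝ h p) (hp : h p ≠ 0) :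
    fderiv ℝ (fun p => g (h p • p) / h p) p = fderiv ℝ g (h p • p) +
      ((h p)⁻¹ ^ 2 * (fderiv ℝ g (h p • p) (h p • p) - g (h p • p))) • fderiv ℝ h p := by
  have hw : HasFDerivAt (fun p => h p • p) _ p := hh.hasFDerivAt.fun_smul (hasFDerivAt_id p)
  have hgw : HasFDerivAt (fun p => g (h p • p)) _ p :=
    hg.hasFDerivAt.comp (f := fun p => h p • p) p hw
  have h_inv := (hasDerivAt_inv hp).comp_hasFDerivAt p hh.hasFDerivAt
  simp only [div_eq_mul_inv]
  refine ((hgw.fun_mul h_inv).congr_fderiv ?_).fderiv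
  ext v
  simp only [neg_smul, Function.comp_apply, ContinuousLinearMap.comp_add,
    ContinuousLinearMap.comp_smul, ContinuousLinearMap.comp_id, smul_add, smul_neg, add_apply,
    neg_apply, smul_apply, smul_eq_mul, ContinuousLinearMap.comp_apply,
    ContinuousLinearMap.smulRight_apply, map_smul, inv_pow]
  field_simp
  ring

theorem fderiv_comp_smul_div_tendsto (hg : ContDiffAt ℝ 1 g 0) (hg0 : g 0 = 0)
    (hh : ∀ᶠ p in 𝓝[≠] 0, h p ≠ 0 ∧ DifferentiableAt ℝ h p)
    (hb : h =O[𝓝 0] (1 : E → ℝ)) (hc : h⁻¹ =O[𝓝 0] (1 : E → ℝ))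
    (hh' : fderiv ℝ h =O[𝓝[≠] 0] (fun p => ‖p‖⁻¹ : E → ℝ)) :
    Tendsto (fderiv ℝ (fun p => g (h p • p) / h p)) (𝓝[≠] 0) (𝓝 (fderiv ℝ g 0)) := by
  have smul_tendsto := (smul_self_tendsto_zero hb).mono_left (nhdsWithin_le_nhds (s := {0}ᶜ))
  have correction : Tendsto (fun p => ((h p)⁻¹ ^ 2 *
      (fderiv ℝ g (h p • p) (h p • p) - g (h p • p))) • fderiv ℝ h p) (𝓝[≠] 0) (𝓝 0) := by
    have euler_defect : (fun p => fderiv ℝ g (h p • p) (h p • p) - g (h p • p)) =o[𝓝[≠] 0]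
        (fun p => ‖p‖) :=
      (((fderiv_apply_self_sub_isLittleO hg hg0).comp_tendsto smul_tendsto).trans_isBigO
        ((smul_self_isBigO hb).mono nhdsWithin_le_nhds)).norm_right
    have product :=
      (((hc.mono nhdsWithin_le_nhds).pow 2).mul_isLittleO euler_defect).smul_isBigO hh'
    refine (isLittleO_one_iff ℝ).1 (product.congr' .rfl ?_)
    filter_upwards [self_mem_nhdsWithin] with p hp
    simp [mul_inv_cancel₀ (norm_ne_zero_iff.2 hp)]
  have limit := ((hg.continuousAt_fderiv one_ne_zero).tendsto.comp smul_tendsto).add correction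
  rw [add_zero] at limit
  refine limit.congr' ?_
  filter_upwards [hh, smul_tendsto.eventually (hg.eventually (by simp))] with p hp hgp
  exact (fderiv_comp_smul_div (hgp.differentiableAt one_ne_zero) hp.2 hp.1).symm

theorem contDiffAt_one_comp_smul_div (hg : ContDiffAt ℝ 1 g 0) (hg0 : g 0 = 0)
    (hh : ∀ᶠ p in 𝓝 0, h p ≠ 0) (hb : h =O[𝓝 0] (1 : E → ℝ)) (hc : h⁻¹ =O[𝓝 0] (1 : E → ℝ))
    (hh1 : ∀ᶠ p in 𝓝[≠] 0, ContDiffAt ℝ 1 h p)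
    (hh' : fderiv ℝ h =O[𝓝[≠] 0] (fun p => ‖p‖⁻¹ : E → ℝ)) :
    ContDiffAt ℝ 1 (fun p => g (h p • p) / h p) 0 := by
  have hh_punctured := (hh.filter_mono (nhdsWithin_le_nhds (s := {0}ᶜ))).and hh1
  refine contDiffAt_one_of_tendsto_fderiv ?_
    (hasFDerivAt_comp_smul_div (hg.differentiableAt one_ne_zero) hg0 hh hb hc)
    (fderiv_comp_smul_div_tendsto hg hg0
      (hh_punctured.mono fun p hp => ⟨hp.1, hp.2.differentiableAt one_ne_zero⟩) hb hc hh')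
  have hg1 : ∀ᶠ p in 𝓝[≠] 0, ContDiffAt ℝ 1 g (h p • p) :=
    ((smul_self_tendsto_zero hb).mono_left nhdsWithin_le_nhds).eventually (hg.eventually (by simp))
  filter_upwards [hh_punctured, hg1] with p hp hgp
  have h1 : ContDiffAt ℝ 1 (fun p => g (h p • p) / h p) p :=
    (hgp.comp (f := fun p => h p • p) p (hp.2.smul contDiffAt_id)).div hp.2 hp.1
  exact ⟨h1.differentiableAt one_ne_zero, h1.continuousAt_fderiv one_ne_zero⟩

end ExtensionOverPoint

section DirectionalFunctions

variable {E β : Type*} [NormedAddCommGroup E] [NormedSpace ℝ E]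

/-- A function is directional if it is constant on each open ray from the origin, that is,
positively homogeneous of degree `0`. -/
def IsDirectional (f : E → β) : Prop := ∀ ⦃s : ℝ⦄, 0 < s → ∀ p, f (s • p) = f p

namespace IsDirectional

theorem inv {h : E → ℝ} (hh : IsDirectional h) : IsDirectional h⁻¹ :=
  fun _ hs p => congr($(hh hs p)⁻¹)

theorem fderiv_apply_self {h : E → ℝ} (hh : IsDirectional h) {p : E}
    (hp : DifferentiableAt ℝ h p) : fderiv ℝ h p p = 0 := by
  have along_ray : HasDerivAt (fun s : ℝ => h (s • p)) (fderiv ℝ h p p) 1 := by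
    have hray : HasDerivAt (fun s : ℝ => s • p) p 1 := by
      simpa using (hasDerivAt_id (1 : ℝ)).smul_const p
    refine HasFDerivAt.comp_hasDerivAt (1 : ℝ) (l := h) ?_ hray
    rw [one_smul]
    exact hp.hasFDerivAt
  have constant : (fun s : ℝ => h (s • p)) =ᶠ[𝓝 1] fun _ => h p :=
    (lt_mem_nhds one_pos).mono fun s hs => hh hs p
  exact along_ray.unique ((hasDerivAt_const 1 (h p)).congr_of_eventuallyEq constant)

theorem norm_smul_fderiv {h : E → ℝ} (hh : IsDirectional h) :
    IsDirectional fun p => ‖p‖ • fderiv ℝ h p := by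
  intro s hs p
  have scaling : fderiv ℝ h p = s • fderiv ℝ h (s • p) := by
    rw [← fderiv_comp_smul, funext (hh hs)]
  dsimp only
  rw [scaling, norm_smul, Real.norm_of_nonneg hs.le, smul_smul, mul_comm]

variable [FiniteDimensional ℝ E]

theorem isBigO_one {F : Type*} [NormedAddCommGroup F] {f : E → F} (hf : IsDirectional f)
    (hc : ContinuousOn f {0}ᶜ) : f =O[⊤] (1 : E → ℝ) := by
  have hsphere : Metric.sphere (0 : E) 1 ⊆ {0}ᶜ := fun p hp =>
    ne_zero_of_mem_unit_sphere ⟨p, hp⟩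
  obtain ⟨K, hK⟩ := (isCompact_sphere (0 : E) 1).exists_bound_of_continuousOn (hc.mono hsphere)
  refine Asymptotics.isBigO_top.2 ⟨max K ‖f 0‖, fun p => ?_⟩
  rw [Pi.one_apply, norm_one, mul_one]
  rcases eq_or_ne p 0 with rfl | hp
  · exact le_max_right _ _
  · rw [← hf (inv_pos.2 (norm_pos_iff.2 hp))]
    exact (hK _ (by simp [norm_smul, hp])).trans (le_max_left _ _)

theorem fderiv_isBigO {h : E → ℝ} (hh : IsDirectional h)
    (hc : ContinuousOn (fderiv ℝ h) {0}ᶜ) :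
    fderiv ℝ h =O[𝓝[≠] 0] (fun p => ‖p‖⁻¹ : E → ℝ) := by
  have bounded := (hh.norm_smul_fderiv.isBigO_one (continuous_norm.continuousOn.smul hc)).mono
    (le_top (a := 𝓝[≠] 0))
  refine ((Asymptotics.isBigO_refl (fun p : E => ‖p‖⁻¹) (𝓝[≠] 0)).smul bounded).congr' ?_ ?_
  · filter_upwards [self_mem_nhdsWithin] with p hp
    exact inv_smul_smul₀ (norm_ne_zero_iff.2 hp) _
  · simp

end IsDirectional

end DirectionalFunctions

section ConicalDiffeos

variable {E : Type*} [NormedAddCommGroup E] [NormedSpace ℝ E]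

/-- A homeomorphism of a normed space is a conical diffeomorphism if it is a `C^1` diffeomorphism
off the origin and, near the origin, multiplies each vector by a positive factor that only depends
on the direction of the vector. -/
structure IsConicalDiffeo (T : E ≃ₜ E) : Prop where
  contDiffAt : ∀ p ≠ 0, ContDiffAt ℝ 1 T p
  contDiffAt_symm : ∀ q ≠ 0, ContDiffAt ℝ 1 T.symm q
  exists_factor : ∃ h : E → ℝ, IsDirectional h ∧ (∀ p, 0 < h p) ∧
    (∀ p ≠ 0, ContDiffAt ℝ 1 h p) ∧ ∀ᶠ p in 𝓝 0, T p = h p • p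

namespace IsConicalDiffeo

theorem map_zero {T : E ≃ₜ E} (hT : IsConicalDiffeo T) : T 0 = 0 := by
  obtain ⟨h, -, -, -, hTh⟩ := hT.exists_factor
  simpa using hTh.self_of_nhds

theorem symm [FiniteDimensional ℝ E] {T : E ≃ₜ E} (hT : IsConicalDiffeo T) :
    IsConicalDiffeo T.symm := by
  obtain ⟨h, hh, hpos, hh1, hTh⟩ := hT.exists_factor
  have hinv1 : ∀ p ≠ 0, ContDiffAt ℝ 1 h⁻¹ p := fun p hp => (hh1 p hp).inv (hpos p).ne'
  refine ⟨hT.contDiffAt_symm, hT.contDiffAt, h⁻¹, hh.inv, fun p => inv_pos.2 (hpos p), hinv1, ?_⟩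
  have bounded := (hh.inv.isBigO_one fun p hp => (hinv1 p hp).continuousAt.continuousWithinAt).mono
    (le_top (a := 𝓝 0))
  filter_upwards [(smul_self_tendsto_zero bounded).eventually hTh] with q hq
  rw [T.symm_apply_eq, hq, Pi.inv_apply, hh (inv_pos.2 (hpos q)), smul_inv_smul₀ (hpos q).ne']

end IsConicalDiffeo

end ConicalDiffeos

section PullingBack

variable {S : Type*} [TopologicalSpace S] [ChartedSpace Plane S]

/-- The preimage under `f` of a one-dimensional `C^k` submanifold is again one, locally near each of
its points. -/
def PullsBackCkSubmanifolds (k : ℕ∞) (f : S → S) : Prop :=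
  ∀ C x, f x ∈ C → IsCkOneSubmanifoldAt k C (f x) → IsCkOneSubmanifoldAt k (f ⁻¹' C) x

variable {k : ℕ∞} {f : S ≃ₜ S} {C : Set S}

theorem IsCkCurve.image_homeomorph (hC : IsCkCurve k C) (hf : PullsBackCkSubmanifolds k f.symm) :
    IsCkCurve k (f '' C) := by
  obtain ⟨closed, connected, submanifold⟩ := hC
  refine ⟨f.isClosedMap _ closed, connected.image f f.continuous.continuousOn, ?_⟩
  rw [f.image_eq_preimage_symm]
  exact fun x hx => hf C x hx (submanifold _ hx)

theorem IsSimpleClosedCkCurve.image_homeomorph (hC : IsSimpleClosedCkCurve k C)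
    (hf : PullsBackCkSubmanifolds k f.symm) : IsSimpleClosedCkCurve k (f '' C) :=
  ⟨hC.1.image f.continuous, hC.2.image_homeomorph hf⟩

theorem mem_homeoCk_of_pullsBack (hf : PullsBackCkSubmanifolds k f)
    (hf' : PullsBackCkSubmanifolds k f.symm) : f ∈ HomeoCk k S :=
  ⟨fun _ hC => hC.image_homeomorph hf', fun _ hC => hC.image_homeomorph hf⟩

theorem mem_properHomeoCk_of_pullsBack (hf : PullsBackCkSubmanifolds k f)
    (hf' : PullsBackCkSubmanifolds k f.symm) : f ∈ ProperHomeoCk k S :=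
  ⟨fun _ hC => hC.image_homeomorph hf', fun _ hC => hC.image_homeomorph hf⟩

end PullingBack

namespace IsConicalDiffeo

variable {T : Plane ≃ₜ Plane}

theorem restr_compl_zero_mem_maximalAtlas (hT : IsConicalDiffeo T) :
    T.toOpenPartialHomeomorph.restr {0}ᶜ ∈ IsManifold.maximalAtlas (𝓡 2) 1 Plane := by
  rw [IsManifold.mem_maximalAtlas_iff_contMDiffOn, contMDiffOn_iff_contDiffOn,
    contMDiffOn_iff_contDiffOn]
  refine ⟨fun p hp => (hT.contDiffAt p ?_).contDiffWithinAt,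
    fun q hq => (hT.contDiffAt_symm q ?_).contDiffWithinAt⟩
  · simpa using hp
  · rintro rfl
    simp [hT.symm.map_zero] at hq

theorem exists_isLocalDefiningFunction (hT : IsConicalDiffeo T) {g : Plane → ℝ} {D : Set Plane}
    (hg : IsLocalDefiningFunction 1 g D 0) (h0 : 0 ∈ D) :
    ∃ g', IsLocalDefiningFunction 1 g' (T ⁻¹' D) 0 := by
  obtain ⟨h, hh, hpos, hh1, hTh⟩ := hT.exists_factor
  obtain ⟨hg', hgD⟩ := hg
  have hg1 : ContDiffAt ℝ 1 g 0 := hgD.self_of_nhds.1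
  have hg0 : g 0 = 0 := hgD.self_of_nhds.2.1 h0
  have hcont : ContinuousOn h {0}ᶜ := fun p hp => (hh1 p hp).continuousAt.continuousWithinAt
  have hb := (hh.isBigO_one hcont).mono (le_top (a := 𝓝 0))
  have hc := (hh.inv.isBigO_one (hcont.inv₀ fun p _ => (hpos p).ne')).mono (le_top (a := 𝓝 0))
  have hne : ∀ᶠ p in 𝓝 0, h p ≠ 0 := .of_forall fun p => (hpos p).ne'
  have hfderiv : ContinuousOn (fderiv ℝ h) {0}ᶜ := fun p hp =>
    ((hh1 p hp).continuousAt_fderiv one_ne_zero).continuousWithinAt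
  have C1 := contDiffAt_one_comp_smul_div hg1 hg0 hne hb hc
    (eventually_mem_nhdsWithin.mono hh1) (hh.fderiv_isBigO hfderiv)
  refine ⟨fun p => g (h p • p) / h p, ?_, ?_⟩
  · rwa [(hasFDerivAt_comp_smul_div (hg1.differentiableAt one_ne_zero) hg0 hne hb hc).fderiv]
  · filter_upwards [C1.eventually (by simp), hTh, (smul_self_tendsto_zero hb).eventually hgD]
      with p hp hTp hDp
    simpa [hp, hTp, (hpos p).ne'] using hDp.2

theorem pullsBack (hT : IsConicalDiffeo T) : PullsBackCkSubmanifolds 1 T := by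
  intro D x hxD hD
  rcases eq_or_ne x 0 with rfl | hx
  · rw [hT.map_zero] at hxD hD
    obtain ⟨g, hg⟩ := hD.exists_isLocalDefiningFunction one_ne_zero
    obtain ⟨g', hg'⟩ := hT.exists_isLocalDefiningFunction hg hxD
    exact hg'.isCkOneSubmanifoldAt one_ne_zero
  · refine (isCkOneSubmanifoldAt_symm_preimage_iff hT.restr_compl_zero_mem_maximalAtlas ?_).1 ?_
    · simpa using hx
    · have : T.symm ⁻¹' (T ⁻¹' D) = D := T.toEquiv.symm_preimage_preimage D
      simpa [this] using hD

end IsConicalDiffeo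

section RadialHomeomorphisms

variable {E : Type*} [NormedAddCommGroup E] [NormedSpace ℝ E]

theorem exists_equiv_smul_id_add_smulRight {a : ℝ} {ℓ : E →L[ℝ] ℝ} {x : E} (ha : a ≠ 0)
    (hx : a + ℓ x ≠ 0) :
    ∃ e : E ≃L[ℝ] E, (e : E →L[ℝ] E) = a • ContinuousLinearMap.id ℝ E + ℓ.smulRight x := by
  let A := a • ContinuousLinearMap.id ℝ E + ℓ.smulRight x
  let B := a⁻¹ • (ContinuousLinearMap.id ℝ E - (a + ℓ x)⁻¹ • ℓ.smulRight x)
  refine ⟨.equivOfInverse A B (fun v => ?_) (fun v => ?_), rfl⟩ <;>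
  · simp only [add_apply, sub_apply, smul_apply, ContinuousLinearMap.id_apply,
      ContinuousLinearMap.smulRight_apply, map_add, map_sub, map_smul, A, B]
    match_scalars <;> field_simp
    ring

/-- `h` is a radial factor if `p ↦ h p • p` stretches each ray from the origin increasingly and
`C^1`-smoothly onto itself, with uniform bounds: the condition `0 < h p + fderiv ℝ h p p` says that
`s ↦ s * h (s • p)` has positive derivative. -/
structure IsRadialFactor (h : E → ℝ) : Prop where
  exists_bounds : ∃ c > 0, ∃ b, ∀ p, h p ∈ Icc c b
  contDiffAt : ∀ p ≠ 0, ContDiffAt ℝ 1 h p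
  add_fderiv_pos : ∀ p ≠ 0, 0 < h p + fderiv ℝ h p p

namespace IsRadialFactor

variable {h : E → ℝ}

theorem pos (hh : IsRadialFactor h) (p : E) : 0 < h p := by
  obtain ⟨c, hc, b, hcb⟩ := hh.exists_bounds
  exact hc.trans_le (hcb p).1

theorem hasDerivAt_ray (hh : IsRadialFactor h) {p : E} (hp : p ≠ 0) {s : ℝ} (hs : 0 < s) :
    HasDerivAt (fun s => s * h (s • p)) (h (s • p) + fderiv ℝ h (s • p) (s • p)) s := by
  have ray : HasDerivAt (fun s : ℝ => s • p) p s := by simpa using (hasDerivAt_id s).smul_const p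
  have hh_s := ((hh.contDiffAt _ (smul_ne_zero hs.ne' hp)).differentiableAt one_ne_zero).hasFDerivAt
  simpa using (hasDerivAt_id' s).fun_mul (hh_s.comp_hasDerivAt s ray)

theorem strictMonoOn_ray (hh : IsRadialFactor h) {p : E} (hp : p ≠ 0) :
    StrictMonoOn (fun s => s * h (s • p)) (Ioi 0) := by
  refine strictMonoOn_of_deriv_pos (convex_Ioi 0)
    (fun s hs => (hh.hasDerivAt_ray hp hs).continuousAt.continuousWithinAt) fun s hs => ?_
  rw [interior_Ioi] at hs
  rw [(hh.hasDerivAt_ray hp hs).deriv]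
  exact hh.add_fderiv_pos _ (smul_ne_zero (ne_of_gt hs) hp)

theorem continuous_smul_self (hh : IsRadialFactor h) : Continuous fun p => h p • p := by
  obtain ⟨c, -, b, hcb⟩ := hh.exists_bounds
  refine continuous_iff_continuousAt.2 fun p => ?_
  rcases eq_or_ne p 0 with rfl | hp
  · have bounded : h =O[𝓝 0] (1 : E → ℝ) := .of_bound b <| .of_forall fun p => by
      simpa [abs_of_pos (hh.pos p)] using (hcb p).2
    simpa [ContinuousAt] using smul_self_tendsto_zero bounded
  · exact (hh.contDiffAt p hp).continuousAt.smul continuousAt_id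

theorem injective_smul_self (hh : IsRadialFactor h) : Function.Injective fun p => h p • p := by
  intro p q hpq
  have hq : q = (h p / h q) • p := by
    rw [div_eq_inv_mul, mul_smul, eq_inv_smul_iff₀ (hh.pos q).ne']
    exact hpq.symm
  rcases eq_or_ne p 0 with rfl | hp
  · simpa using hq.symm
  · have same_value : h p / h q * h ((h p / h q) • p) = 1 * h ((1 : ℝ) • p) := by
      rw [← hq, one_smul, one_mul, div_mul_cancel₀ _ (hh.pos q).ne']
    have ratio_eq_one := (hh.strictMonoOn_ray hp).injOn (div_pos (hh.pos p) (hh.pos q))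
      (mem_Ioi.2 one_pos) same_value
    rw [hq, ratio_eq_one, one_smul]

theorem surjective_smul_self (hh : IsRadialFactor h) : Function.Surjective fun p => h p • p := by
  obtain ⟨c, hc, b, hcb⟩ := hh.exists_bounds
  intro q
  rcases eq_or_ne q 0 with rfl | hq
  · exact ⟨0, smul_zero _⟩
  have hb : 0 < b := hc.trans_le ((hcb 0).1.trans (hcb 0).2)
  have continuousOn_ray : ContinuousOn (fun s => s * h (s • q)) (Icc b⁻¹ c⁻¹) := fun s hs =>
    (hh.hasDerivAt_ray hq ((inv_pos.2 hb).trans_le hs.1)).continuousAt.continuousWithinAt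
  have one_mem : (1 : ℝ) ∈ Icc (b⁻¹ * h (b⁻¹ • q)) (c⁻¹ * h (c⁻¹ • q)) :=
    ⟨(inv_mul_le_one₀ hb).2 (hcb _).2, (one_le_inv_mul₀ hc).2 (hcb _).1⟩
  obtain ⟨s, -, hs⟩ := intermediate_value_Icc
    (inv_anti₀ hc ((hcb 0).1.trans (hcb 0).2)) continuousOn_ray one_mem
  refine ⟨s • q, ?_⟩
  simp only at hs ⊢
  rw [smul_smul, mul_comm, hs, one_smul]

variable [FiniteDimensional ℝ E]

theorem isClosedMap_smul_self (hh : IsRadialFactor h) : IsClosedMap fun p => h p • p := by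
  obtain ⟨c, hc, b, hcb⟩ := hh.exists_bounds
  have := FiniteDimensional.proper_real E
  refine (isProperMap_iff_tendsto_cocompact.2 ⟨hh.continuous_smul_self, ?_⟩).isClosedMap
  rw [← Metric.cobounded_eq_cocompact, ← tendsto_norm_atTop_iff_cobounded]
  refine tendsto_atTop_mono (fun p => ?_) (tendsto_norm_cobounded_atTop.const_mul_atTop hc)
  rw [norm_smul, Real.norm_of_nonneg (hh.pos p).le]
  gcongr
  exact (hcb p).1

/-- The homeomorphism `p ↦ h p • p` defined by a radial factor `h`. -/
noncomputable def homeomorph (hh : IsRadialFactor h) : E ≃ₜ E :=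
  (Equiv.ofBijective _ ⟨hh.injective_smul_self, hh.surjective_smul_self⟩)
    |>.toHomeomorphOfContinuousClosed hh.continuous_smul_self hh.isClosedMap_smul_self

@[simp]
theorem homeomorph_apply (hh : IsRadialFactor h) (p : E) : hh.homeomorph p = h p • p := rfl

theorem contDiffAt_homeomorph (hh : IsRadialFactor h) {p : E} (hp : p ≠ 0) :
    ContDiffAt ℝ 1 hh.homeomorph p := (hh.contDiffAt p hp).smul contDiffAt_id

theorem contDiffAt_homeomorph_symm (hh : IsRadialFactor h) {q : E} (hq : q ≠ 0) :
    ContDiffAt ℝ 1 hh.homeomorph.symm q := by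
  have hp : hh.homeomorph.symm q ≠ 0 := fun h0 => hq <| by
    rw [hh.homeomorph.symm_apply_eq, homeomorph_apply, smul_zero] at h0
    exact h0
  set p := hh.homeomorph.symm q
  obtain ⟨e, he⟩ := exists_equiv_smul_id_add_smulRight (hh.pos p).ne' (hh.add_fderiv_pos p hp).ne'
  refine hh.homeomorph.toOpenPartialHomeomorph.contDiffAt_symm (f₀' := e) (mem_univ q) ?_
    (hh.contDiffAt_homeomorph hp)
  rw [he]
  exact ((hh.contDiffAt p hp).differentiableAt one_ne_zero).hasFDerivAt.smul (hasFDerivAt_id p)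

theorem isConicalDiffeo_homeomorph (hh : IsRadialFactor h) {h₀ : E → ℝ} (hh₀ : IsDirectional h₀)
    (hpos : ∀ p, 0 < h₀ p) (hh₀1 : ∀ p ≠ 0, ContDiffAt ℝ 1 h₀ p) (heq : h =ᶠ[𝓝 0] h₀) :
    IsConicalDiffeo hh.homeomorph where
  contDiffAt _ := hh.contDiffAt_homeomorph
  contDiffAt_symm _ := hh.contDiffAt_homeomorph_symm
  exists_factor := ⟨h₀, hh₀, hpos, hh₀1, heq.mono fun p hp => by rw [homeomorph_apply, hp]⟩

end IsRadialFactor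

variable {θ : E → ℝ} {c : ℝ}

theorem IsDirectional.isRadialFactor_const_add_mul (hθ : IsDirectional θ) (hθ_le : ∀ p, |θ p| ≤ 1)
    (hθ1 : ∀ p ≠ 0, ContDiffAt ℝ 1 θ p) {χ : E → ℝ} (hχ : ContDiff ℝ 1 χ) {b : ℝ} (hbc : b < c)
    (hχ_le : ∀ p, |χ p| ≤ b) (hχ' : ∀ p, |χ p + fderiv ℝ χ p p| < c) :
    IsRadialFactor fun p => c + χ p * θ p where
  exists_bounds := by
    refine ⟨c - b, sub_pos.2 hbc, c + b, fun p => ?_⟩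
    have : |χ p * θ p| ≤ b := by
      rw [abs_mul]
      exact (mul_le_of_le_one_right (abs_nonneg _) (hθ_le p)).trans (hχ_le p)
    constructor <;> linarith [abs_le.1 this]
  contDiffAt p hp := contDiffAt_const.add (hχ.contDiffAt.mul (hθ1 p hp))
  add_fderiv_pos p hp := by
    have hθp := (hθ1 p hp).differentiableAt one_ne_zero
    have deriv_eq : fderiv ℝ (fun p => c + χ p * θ p) p p = θ p * fderiv ℝ χ p p := by
      have hχp := (hχ.differentiable one_ne_zero p).hasFDerivAt
      rw [((hχp.fun_mul hθp.hasFDerivAt).const_add c).fderiv]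
      simp [hθ.fderiv_apply_self hθp]
    have : |(χ p + fderiv ℝ χ p p) * θ p| < c := by
      rw [abs_mul]
      exact (mul_le_of_le_one_right (abs_nonneg _) (hθ_le p)).trans_lt (hχ' p)
    rw [deriv_eq]
    linarith [(abs_lt.1 this).1]

theorem IsDirectional.exists_isConicalDiffeo [FiniteDimensional ℝ E] (hθ : IsDirectional θ)
    (hθ_le : ∀ p, |θ p| ≤ 1) (hθ1 : ∀ p ≠ 0, ContDiffAt ℝ 1 θ p) {χ : E → ℝ} (hχ : ContDiff ℝ 1 χ)
    {b χ₀ : ℝ} (hbc : b < c) (hχ_le : ∀ p, |χ p| ≤ b) (hχ' : ∀ p, |χ p + fderiv ℝ χ p p| < c)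
    (hχ₀ : ∀ᶠ p in 𝓝 0, χ p = χ₀) :
    ∃ T : E ≃ₜ E, IsConicalDiffeo T ∧ ∀ p, T p = (c + χ p * θ p) • p := by
  have hfactor := hθ.isRadialFactor_const_add_mul hθ_le hθ1 hχ hbc hχ_le hχ'
  refine ⟨hfactor.homeomorph, hfactor.isConicalDiffeo_homeomorph (h₀ := fun p => c + χ₀ * θ p)
    (fun s hs p => congr(c + χ₀ * $(hθ hs p))) (fun p => ?_)
    (fun p hp => contDiffAt_const.add (contDiffAt_const.mul (hθ1 p hp)))
    (hχ₀.mono fun p hp => congr(c + $hp * θ p)), hfactor.homeomorph_apply⟩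
  have : |χ₀ * θ p| < c := by
    rw [abs_mul]
    exact (mul_le_of_le_one_right (abs_nonneg _) (hθ_le p)).trans_lt
      (hχ₀.self_of_nhds ▸ (hχ_le 0).trans_lt hbc)
  linarith [(abs_lt.1 this).1]

end RadialHomeomorphisms

section Cosine

/-- The cosine of the argument of a point of the plane. At the origin division by zero makes it
`0`. -/
noncomputable def cosArg (p : Plane) : ℝ := p 0 / ‖p‖

theorem isDirectional_cosArg : IsDirectional cosArg := fun s hs p => by
  rw [cosArg, cosArg, norm_smul, Real.norm_of_nonneg hs.le, PiLp.smul_apply, smul_eq_mul,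
    mul_div_mul_left _ _ hs.ne']

theorem abs_cosArg_le_one (p : Plane) : |cosArg p| ≤ 1 := by
  rw [cosArg, abs_div, abs_norm]
  exact div_le_one_of_le₀ (PiLp.norm_apply_le p 0) (norm_nonneg p)

theorem contDiffAt_cosArg {n : WithTop ℕ∞} {p : Plane} (hp : p ≠ 0) : ContDiffAt ℝ n cosArg p :=
  (EuclideanSpace.proj 0 : Plane →L[ℝ] ℝ).contDiff.contDiffAt.div
    (contDiffAt_norm ℝ hp) (norm_ne_zero_iff.2 hp)

end Cosine

section SecondOrderTaylor

variable {E F : Type*} [NormedAddCommGroup E] [NormedSpace ℝ E] [NormedAddCommGroup F]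
  [NormedSpace ℝ F] {g : E → F} {x : E}

theorem taylor_two_isLittleO (hg : ContDiffAt ℝ 2 g x) :
    (fun y => g y - g x - fderiv ℝ g x (y - x)
      - (1 / 2 : ℝ) • fderiv ℝ (fderiv ℝ g) x (y - x) (y - x))
      =o[𝓝 x] fun y => ‖y - x‖ ^ 2 := by
  set ℓ := fderiv ℝ g x
  set Q := fderiv ℝ (fderiv ℝ g) x
  have symmetric (v w : E) : Q v w = Q w v := hg.isSymmSndFDerivAt (by simp) v w
  obtain ⟨r, hr, hball⟩ := Metric.eventually_nhds_iff_ball.1 (hg.eventually (by simp))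
  have hasFDerivAt_remainder : ∀ y ∈ Metric.ball x r,
      HasFDerivAt (fun y => g y - ℓ (y - x) - (1 / 2 : ℝ) • Q (y - x) (y - x))
        (fderiv ℝ g y - ℓ - Q (y - x)) y := by
    intro y hy
    have hsub := (hasFDerivAt_id (𝕜 := ℝ) y).sub_const x
    refine ((((hball y hy).differentiableAt two_ne_zero).hasFDerivAt.fun_sub
      (ℓ.hasFDerivAt.comp y hsub)).fun_sub
        (((Q.hasFDerivAt.comp y hsub).clm_apply hsub).const_smul (1 / 2 : ℝ))).congr_fderiv ?_
    ext v
    simp only [ContinuousLinearMap.comp_id, one_div, id_eq, Function.comp_apply, map_sub, smul_add,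
      sub_apply, add_apply, smul_apply, ContinuousLinearMap.flip_apply, symmetric v, sub_right_inj]
    module
  have fderiv_remainder : (fun y => fderiv ℝ g y - ℓ - Q (y - x))
      =o[𝓝[Metric.ball x r] x] fun y => ‖y - x‖ ^ 1 := by
    simp_rw [pow_one, Asymptotics.isLittleO_norm_right]
    exact (hasFDerivAt_iff_isLittleO.1 ((hg.fderiv_right (m := 1) (by norm_num)).differentiableAt
      one_ne_zero).hasFDerivAt).mono nhdsWithin_le_nhds
  have := (convex_ball x r).isLittleO_pow_succ (Metric.mem_ball_self hr)
    (fun y hy => (hasFDerivAt_remainder y hy).hasFDerivWithinAt) fderiv_remainder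
  rw [Metric.isOpen_ball.nhdsWithin_eq (Metric.mem_ball_self hr)] at this
  refine this.congr_left fun y => ?_
  simp only [sub_self, map_zero, smul_zero, sub_zero]
  abel

theorem tendsto_sq_smul_sub_sub_fderiv (hg : ContDiffAt ℝ 2 g x) {α : Type*} {l : Filter α}
    {c : α → ℝ} {d : α → E} {v : E} (hd : Tendsto d l (𝓝 0))
    (hcd : Tendsto (fun a => c a • d a) l (𝓝 v)) :
    Tendsto (fun a => c a ^ 2 • (g (x + d a) - g x - fderiv ℝ g x (d a))) l
      (𝓝 ((1 / 2 : ℝ) • fderiv ℝ (fderiv ℝ g) x v v)) := by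
  set Q := fderiv ℝ (fderiv ℝ g) x
  have hxd : Tendsto (fun a => x + d a) l (𝓝 x) := by simpa using hd.const_add x
  have taylor := (taylor_two_isLittleO hg).comp_tendsto hxd
  simp only [Function.comp_def, add_sub_cancel_left] at taylor
  have remainder : Tendsto (fun a => c a ^ 2 • (g (x + d a) - g x - fderiv ℝ g x (d a)
      - (1 / 2 : ℝ) • Q (d a) (d a))) l (𝓝 0) := by
    refine (((Asymptotics.isBigO_refl (fun a => c a ^ 2) l).smul_isLittleO taylor).trans_isBigO
      ?_).tendsto_zero_of_tendsto (hcd.norm.pow 2)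
    refine .of_norm_le fun a => ?_
    simp [norm_smul, mul_pow]
  have main_term : Tendsto (fun a => (1 / 2 : ℝ) • Q (c a • d a) (c a • d a)) l
      (𝓝 ((1 / 2 : ℝ) • Q v v)) :=
    ((Q.continuous₂.tendsto (v, v)).comp (hcd.prodMk_nhds hcd)).const_smul _
  rw [← zero_add ((1 / 2 : ℝ) • Q v v)]
  refine (remainder.add main_term).congr fun a => ?_
  simp only [map_smul, smul_apply]
  module

end SecondOrderTaylor

section CurvatureJump

/-- The standard parametrization of the parabola `y = x²`, with the point of parameter `t` scaled by
`m t`. -/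
noncomputable def scaledParabola (m : ℝ → ℝ) (t : ℝ) : Plane := m t • !₂[t, t ^ 2]

variable {m : ℝ → ℝ} {l : Filter ℝ}

theorem scaledParabola_eq_smul (m : ℝ → ℝ) (t : ℝ) :
    scaledParabola m t =
      (m t * t) • EuclideanSpace.single 0 1 + (m t * t ^ 2) • EuclideanSpace.single 1 1 := by
  ext i
  fin_cases i <;> simp [scaledParabola]

theorem tendsto_inv_smul_scaledParabola {a : ℝ} (hl : l ≤ 𝓝[≠] 0) (hm : Tendsto m l (𝓝 a)) :
    Tendsto (fun t => t⁻¹ • scaledParabola m t) l (𝓝 (a • EuclideanSpace.single 0 1)) := by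
  have ht : Tendsto (fun t : ℝ => t) l (𝓝 0) := tendsto_id.mono_left (hl.trans nhdsWithin_le_nhds)
  have := (hm.smul_const (EuclideanSpace.single 0 1 : Plane)).add
    ((hm.mul ht).smul_const (EuclideanSpace.single 1 1 : Plane))
  rw [mul_zero, zero_smul, add_zero] at this
  refine this.congr' ?_
  filter_upwards [hl self_mem_nhdsWithin] with t (ht : t ≠ 0)
  rw [scaledParabola_eq_smul, smul_add, smul_smul, smul_smul]
  congr 2 <;> field_simp

theorem tendsto_scaledParabola {a : ℝ} (hl : l ≤ 𝓝 0) (hm : Tendsto m l (𝓝 a)) :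
    Tendsto (scaledParabola m) l (𝓝 0) := by
  have hcont : Continuous fun t : ℝ => (!₂[t, t ^ 2] : Plane) := by fun_prop
  have h0 : (!₂[0, 0 ^ 2] : Plane) = 0 := by ext i; fin_cases i <;> simp
  have := hm.smul ((hcont.tendsto 0).mono_left hl)
  rwa [h0, smul_zero] at this

/-- The second condition says that the parametrization `scaledParabola m` and the level set
`{g = 0}` have the same curvature at the origin. -/
theorem fderiv_eq_zero_and_of_comp_scaledParabola_eq_zero {g : Plane → ℝ} (hg : ContDiffAt ℝ 2 g 0)
    {a : ℝ} (ha : a ≠ 0) [l.NeBot] (hl : l ≤ 𝓝[≠] 0) (hm : Tendsto m l (𝓝 a))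
    (hgm : ∀ᶠ t in l, g (scaledParabola m t) = 0) :
    fderiv ℝ g 0 (EuclideanSpace.single 0 1) = 0 ∧
      fderiv ℝ (fderiv ℝ g) 0 (EuclideanSpace.single 0 1) (EuclideanSpace.single 0 1) / 2 * a =
        -fderiv ℝ g 0 (EuclideanSpace.single 1 1) := by
  set e₁ : Plane := EuclideanSpace.single 0 1
  set ℓ := fderiv ℝ g 0
  have hd := tendsto_scaledParabola (hl.trans nhdsWithin_le_nhds) hm
  have hcd := tendsto_inv_smul_scaledParabola hl hm
  have hg0 : g 0 = 0 := tendsto_nhds_unique (hg.continuousAt.tendsto.comp hd)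
    (tendsto_const_nhds.congr' (hgm.mono fun t ht => ht.symm))
  have horizontal : ℓ e₁ = 0 := by
    have hlim : Tendsto (fun t => t⁻¹ • (g (0 + scaledParabola m t) - g 0)) l (𝓝 (ℓ (a • e₁))) :=
      (hg.differentiableAt two_ne_zero).hasFDerivAt.hasFDerivWithinAt.lim (s := univ) hd
        (.of_forall fun _ => mem_univ _) hcd
    have := tendsto_nhds_unique hlim ((tendsto_const_nhds (x := 0)).congr' (hgm.mono fun t ht => by
      simp [ht, hg0]))
    simpa [ha] using this
  refine ⟨horizontal, ?_⟩
  have hlim := tendsto_sq_smul_sub_sub_fderiv hg hd hcd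
  have := tendsto_nhds_unique hlim (((hm.mul_const (ℓ (EuclideanSpace.single 1 1))).neg).congr' ?_)
  · refine mul_left_cancel₀ ha ?_
    simp only [map_smul, smul_apply, smul_eq_mul] at this
    linear_combination this
  · filter_upwards [hgm, hl self_mem_nhdsWithin] with t hgt (ht : t ≠ 0)
    rw [zero_add, hgt, hg0, scaledParabola_eq_smul, map_add, map_smul, map_smul, horizontal]
    simp only [smul_eq_mul]
    field_simp
    ring

theorem IsCkOneSubmanifoldAt.eq_of_scaledParabola_mem {D : Set Plane}
    (hD : IsCkOneSubmanifoldAt 2 D 0) {m₁ m₂ : ℝ → ℝ} {l₁ l₂ : Filter ℝ} [l₁.NeBot] [l₂.NeBot]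
    (hl₁ : l₁ ≤ 𝓝[≠] 0) (hl₂ : l₂ ≤ 𝓝[≠] 0) {a₁ a₂ : ℝ} (ha₁ : a₁ ≠ 0) (ha₂ : a₂ ≠ 0)
    (hm₁ : Tendsto m₁ l₁ (𝓝 a₁)) (hm₂ : Tendsto m₂ l₂ (𝓝 a₂))
    (hD₁ : ∀ᶠ t in l₁, scaledParabola m₁ t ∈ D) (hD₂ : ∀ᶠ t in l₂, scaledParabola m₂ t ∈ D) :
    a₁ = a₂ := by
  obtain ⟨g, hg', hgD⟩ := hD.exists_isLocalDefiningFunction two_ne_zero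
  have vanishes {m : ℝ → ℝ} {l : Filter ℝ} {a : ℝ} (hl : l ≤ 𝓝[≠] 0) (hm : Tendsto m l (𝓝 a))
      (hmD : ∀ᶠ t in l, scaledParabola m t ∈ D) : ∀ᶠ t in l, g (scaledParabola m t) = 0 := by
    filter_upwards [hmD,
      (tendsto_scaledParabola (hl.trans nhdsWithin_le_nhds) hm).eventually hgD] with t htD ht
    exact ht.2.1 htD
  have hg : ContDiffAt ℝ 2 g 0 := hgD.self_of_nhds.1
  obtain ⟨horizontal, h₁⟩ := fderiv_eq_zero_and_of_comp_scaledParabola_eq_zero hg ha₁ hl₁ hm₁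
    (vanishes hl₁ hm₁ hD₁)
  obtain ⟨-, h₂⟩ := fderiv_eq_zero_and_of_comp_scaledParabola_eq_zero hg ha₂ hl₂ hm₂
    (vanishes hl₂ hm₂ hD₂)
  refine mul_left_cancel₀ (fun h0 => hg' ?_) (h₁.trans h₂.symm)
  rw [h0, zero_mul, zero_eq_neg] at h₁
  refine ContinuousLinearMap.coe_injective <|
    (EuclideanSpace.basisFun (Fin 2) ℝ).toBasis.ext fun i => ?_
  fin_cases i <;> simp [horizontal, h₁]

theorem cosArg_scaledParabola {t : ℝ} (hm : 0 < m t) :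
    cosArg (scaledParabola m t) = SignType.sign t / √(1 + t ^ 2) := by
  have hnorm : ‖(!₂[t, t ^ 2] : Plane)‖ = |t| * √(1 + t ^ 2) := by
    rw [EuclideanSpace.norm_eq, Fin.sum_univ_two, ← Real.sqrt_sq_eq_abs,
      ← Real.sqrt_mul (sq_nonneg t)]
    congr 1
    simp only [Matrix.cons_val_zero, Matrix.cons_val_one, Matrix.cons_val_fin_one,
      Real.norm_eq_abs, sq_abs, norm_pow]
    ring
  rw [scaledParabola, isDirectional_cosArg hm, cosArg, hnorm]
  rcases eq_or_ne t 0 with rfl | ht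
  · simp
  · rw [← mul_div_mul_left _ √(1 + t ^ 2) (abs_ne_zero.2 ht), abs_mul_sign]
    rfl

theorem not_isCkOneSubmanifoldAt_image_of_cosArg {c χ₀ : ℝ} {χ : Plane → ℝ} {T : Plane → Plane}
    (hT : ∀ p, T p = (c + χ p * cosArg p) • p) (hχ : ∀ᶠ p in 𝓝 0, χ p = χ₀) (hχ₀ : 0 < χ₀)
    (hχc : χ₀ < c) {D : Set Plane} (hm : ContinuousAt m 0) (hm0 : 0 < m 0)
    (hD : ∀ᶠ t in 𝓝 0, scaledParabola m t ∈ D) {k : ℕ∞} (hk : 2 ≤ k) :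
    ¬ IsCkOneSubmanifoldAt k (T '' D) 0 := by
  intro hTD
  let f (σ t : ℝ) : ℝ := (c + χ₀ * (σ / √(1 + t ^ 2))) * m t
  have tendsto_f (σ : ℝ) : Tendsto (f σ) (𝓝 0) (𝓝 ((c + χ₀ * σ) * m 0)) := by
    have hcont : Continuous fun t : ℝ => c + χ₀ * (σ / √(1 + t ^ 2)) :=
      continuous_const.add (continuous_const.mul
        (continuous_const.div (by fun_prop) fun t => by positivity))
    simpa [f] using (hcont.tendsto 0).mul hm
  have mem_image : ∀ᶠ t in 𝓝 0, scaledParabola (f (SignType.sign t)) t ∈ T '' D := by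
    filter_upwards [hD, (tendsto_scaledParabola le_rfl hm).eventually hχ,
      hm.eventually_const_lt hm0] with t htD hχt hmt
    refine ⟨_, htD, ?_⟩
    rw [hT, hχt, cosArg_scaledParabola hmt, scaledParabola, smul_smul]
    rfl
  have hpos : (c + χ₀ * 1) * m 0 ≠ 0 := (mul_pos (by linarith) hm0).ne'
  have hneg : (c + χ₀ * -1) * m 0 ≠ 0 := (mul_pos (by linarith) hm0).ne'
  have := (hTD.mono hk).eq_of_scaledParabola_mem (nhdsGT_le_nhdsNE 0) (nhdsLT_le_nhdsNE 0) hpos hneg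
    ((tendsto_f 1).mono_left nhdsWithin_le_nhds) ((tendsto_f (-1)).mono_left nhdsWithin_le_nhds)
    (by
      filter_upwards [mem_image.filter_mono nhdsWithin_le_nhds, self_mem_nhdsWithin]
        with t ht (ht0 : 0 < t)
      simpa [sign_pos ht0] using ht)
    (by
      filter_upwards [mem_image.filter_mono nhdsWithin_le_nhds, self_mem_nhdsWithin]
        with t ht (ht0 : t < 0)
      simpa [sign_neg ht0] using ht)
  linarith [mul_right_cancel₀ hm0.ne' this]

end CurvatureJump

section Curvature

variable {m : ℝ → ℝ} {γ δ : ℝ → Plane} {t : ℝ}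

theorem hasDerivAt_of_forall_apply {ι : Type*} [Fintype ι] {γ : ℝ → EuclideanSpace ℝ ι}
    {γ' : EuclideanSpace ℝ ι} (h : ∀ i, HasDerivAt (fun s => γ s i) (γ' i) t) :
    HasDerivAt γ γ' t :=
  (PiLp.continuousLinearEquiv 2 ℝ fun _ : ι => ℝ).symm.hasFDerivAt.comp_hasDerivAt t
    (hasDerivAt_pi.2 h)

theorem signedCurvature_congr (h : γ =ᶠ[𝓝 t] δ) : signedCurvature γ t = signedCurvature δ t := by
  rw [signedCurvature, signedCurvature, h.deriv.deriv_eq, h.deriv_eq]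

theorem continuous_signedCurvature (hγ : ContDiff ℝ 2 γ) (hγ' : ∀ t, deriv γ t ≠ 0) :
    Continuous (signedCurvature γ) := by
  have C1 : ContDiff ℝ 1 (deriv γ) := hγ.iterate_deriv' 1 1
  have c1 (i : Fin 2) : Continuous fun t => deriv γ t i :=
    (EuclideanSpace.proj i : Plane →L[ℝ] ℝ).continuous.comp C1.continuous
  have c2 (i : Fin 2) : Continuous fun t => deriv (deriv γ) t i :=
    (EuclideanSpace.proj i : Plane →L[ℝ] ℝ).continuous.comp (C1.continuous_deriv le_rfl)
  exact (((c1 0).mul (c2 1)).sub ((c1 1).mul (c2 0))).div (C1.continuous.norm.pow 3)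
    fun t => pow_ne_zero 3 (norm_ne_zero_iff.2 (hγ' t))

theorem contDiff_scaledParabola {n : WithTop ℕ∞} (hm : ContDiff ℝ n m) :
    ContDiff ℝ n (scaledParabola m) :=
  hm.smul <| (contDiff_piLp 2).2 fun i => by
    fin_cases i
    exacts [contDiff_id, contDiff_id.pow 2]

theorem hasDerivAt_scaledParabola {m' : ℝ} (hm : HasDerivAt m m' t) :
    HasDerivAt (scaledParabola m) !₂[m' * t + m t, m' * t ^ 2 + m t * (2 * t)] t := by
  refine hasDerivAt_of_forall_apply fun i => ?_
  fin_cases i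
  · exact (hm.fun_mul (hasDerivAt_id' t)).congr_deriv (by simp)
  · exact (hm.fun_mul (hasDerivAt_pow 2 t)).congr_deriv (by simp)

theorem deriv_scaledParabola_ne_zero (hm : DifferentiableAt ℝ m t) (hmt : m t ≠ 0) :
    deriv (scaledParabola m) t ≠ 0 := by
  rw [(hasDerivAt_scaledParabola hm.hasDerivAt).deriv]
  intro h0
  have h1 : deriv m t * t + m t = 0 := congr($h0 0)
  have h2 : deriv m t * t ^ 2 + m t * (2 * t) = 0 := congr($h0 1)
  have h3 : m t * t = 0 := by linear_combination h2 - t * h1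
  have ht : t = 0 := (mul_eq_zero.1 h3).resolve_left hmt
  exact hmt (by simpa [ht] using h1)

theorem signedCurvature_scaledParabola_zero (hm : ContDiff ℝ 2 m) (hm0 : 0 < m 0) :
    signedCurvature (scaledParabola m) 0 = 2 / m 0 := by
  have C1 : ContDiff ℝ 1 (deriv m) := hm.iterate_deriv' 1 1
  have hm' (t : ℝ) : HasDerivAt m (deriv m t) t := (hm.differentiable two_ne_zero t).hasDerivAt
  have deriv_eq : deriv (scaledParabola m) =
      fun t => !₂[deriv m t * t + m t, deriv m t * t ^ 2 + m t * (2 * t)] :=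
    funext fun t => (hasDerivAt_scaledParabola (hm' t)).deriv
  have deriv_deriv_eq : deriv (deriv (scaledParabola m)) 0 = !₂[2 * deriv m 0, 2 * m 0] := by
    have hm'' := (C1.differentiable one_ne_zero 0).hasDerivAt
    rw [deriv_eq]
    refine HasDerivAt.deriv (hasDerivAt_of_forall_apply fun i => ?_)
    fin_cases i
    · exact ((hm''.fun_mul (hasDerivAt_id' 0)).fun_add (hm' 0)).congr_deriv (by simp [two_mul])
    · exact ((hm''.fun_mul (hasDerivAt_pow 2 0)).fun_add
        ((hm' 0).fun_mul ((hasDerivAt_id' 0).const_mul 2))).congr_deriv (by simp [mul_comm])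
  have hnorm : ‖(!₂[m 0, 0] : Plane)‖ = m 0 := by
    simp [EuclideanSpace.norm_eq, Fin.sum_univ_two, hm0.le]
  rw [signedCurvature, deriv_deriv_eq, deriv_eq]
  have hlin : (fun t => !₂[deriv m t * t + m t, deriv m t * t ^ 2 + m t * (2 * t)]) 0 =
      (!₂[m 0, 0] : Plane) := by simp
  rw [hlin, hnorm]
  change (m 0 * (2 * m 0) - 0 * (2 * deriv m 0)) / m 0 ^ 3 = 2 / m 0
  field_simp
  ring

end Curvature

section ImageOfParabola

theorem mMap_eq_smul (p : Plane) : mMap p = (2 + 1 * cosArg p) • p := by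
  have hm : mFactor p = 2 + 1 * cosArg p := by
    rw [mFactor, cosArg, EuclideanSpace.norm_eq, Fin.sum_univ_two]
    simp only [Real.norm_eq_abs, sq_abs]
    split_ifs with h
    · simp [h]
    · ring
  rw [mMap, hm]
  ext i
  fin_cases i <;> simp [mul_comm]

/-- For `σ = ±1`, the factor by which `M` scales the point of parameter `t` of the half `0 < σ * t`
of the parabola. The formula also makes sense on the other half. -/
noncomputable def halfFactor (σ t : ℝ) : ℝ := 2 + σ / √(1 + t ^ 2)

variable {σ : ℝ}

theorem contDiff_halfFactor {n : WithTop ℕ∞} : ContDiff ℝ n (halfFactor σ) :=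
  contDiff_const.add <| contDiff_const.div
    ((contDiff_const.add (contDiff_id.pow 2)).sqrt fun t => by positivity) fun t => by positivity

theorem halfFactor_pos (hσ : |σ| ≤ 1) (t : ℝ) : 0 < halfFactor σ t := by
  have h1 : 1 ≤ √(1 + t ^ 2) := Real.one_le_sqrt.2 (by linarith [sq_nonneg t])
  have h2 : |σ / √(1 + t ^ 2)| ≤ 1 := by
    rw [abs_div, abs_of_nonneg (Real.sqrt_nonneg _)]
    exact div_le_one_of_le₀ (hσ.trans h1) (Real.sqrt_nonneg _)
  unfold halfFactor
  linarith [(abs_le.1 h2).1]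

theorem imageParam_eq_scaledParabola (t : ℝ) :
    imageParam t = scaledParabola (halfFactor (SignType.sign t)) t := by
  have h1 : (!₂[t, t ^ 2] : Plane) = scaledParabola (fun _ => 1) t := (one_smul ℝ _).symm
  rw [imageParam, mMap_eq_smul, h1, cosArg_scaledParabola one_pos, ← h1, one_mul]
  rfl

theorem imageParam_eventuallyEq {t : ℝ} (ht : t ≠ 0) :
    imageParam =ᶠ[𝓝 t] scaledParabola (halfFactor (SignType.sign t)) := by
  filter_upwards [(continuousAt_sign_of_ne_zero ht).eventually_mem
    ((isOpen_discrete {SignType.sign t}).mem_nhds rfl)] with s hs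
  rw [imageParam_eq_scaledParabola, mem_singleton_iff.1 hs]

theorem contDiffAt_imageParam {t : ℝ} (ht : t ≠ 0) {n : WithTop ℕ∞} : ContDiffAt ℝ n imageParam t :=
  (contDiff_scaledParabola contDiff_halfFactor).contDiffAt.congr_of_eventuallyEq
    (imageParam_eventuallyEq ht)

theorem deriv_imageParam_ne_zero {t : ℝ} (ht : t ≠ 0) : deriv imageParam t ≠ 0 := by
  rw [(imageParam_eventuallyEq ht).deriv_eq]
  refine deriv_scaledParabola_ne_zero
    ((contDiff_halfFactor (n := 1)).differentiable one_ne_zero t) (halfFactor_pos ?_ t).ne'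
  rcases SignType.sign t <;> simp

theorem tendsto_signedCurvature_imageParam {l : Filter ℝ} (hl : l ≤ 𝓝[≠] 0) (hσ : |σ| ≤ 1)
    (hsign : ∀ᶠ t in l, SignType.sign t = σ) :
    Tendsto (signedCurvature imageParam) l (𝓝 (2 / (2 + σ))) := by
  have hcont := continuous_signedCurvature (contDiff_scaledParabola (contDiff_halfFactor (σ := σ)))
    fun t => deriv_scaledParabola_ne_zero
      ((contDiff_halfFactor (n := 1)).differentiable one_ne_zero t) (halfFactor_pos hσ t).ne'
  have hlim := (hcont.tendsto 0).mono_left (hl.trans nhdsWithin_le_nhds)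
  rw [signedCurvature_scaledParabola_zero contDiff_halfFactor (halfFactor_pos hσ 0)] at hlim
  have h0 : halfFactor σ 0 = 2 + σ := by simp [halfFactor]
  rw [h0] at hlim
  refine hlim.congr' ?_
  filter_upwards [hl self_mem_nhdsWithin, hsign] with t ht hσt
  rw [signedCurvature_congr (imageParam_eventuallyEq ht), hσt]

end ImageOfParabola

section CompactlySupportedExample

theorem exists_bound_fderiv_apply_self_of_hasCompactSupport {E : Type*} [NormedAddCommGroup E]
    [NormedSpace ℝ E] {χ : E → ℝ} (hχ : HasCompactSupport χ) (hχ1 : ContDiff ℝ 1 χ) :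
    ∃ b, ∀ p, |fderiv ℝ χ p p| ≤ b := by
  have hsupp : HasCompactSupport fun p => fderiv ℝ χ p p :=
    (hχ.fderiv ℝ).mono fun p hp h0 => hp (by simp [h0])
  exact hsupp.exists_bound_of_continuous
    ((hχ1.continuous_fderiv one_ne_zero).clm_apply continuous_id)

theorem exists_isConicalDiffeo_eq_self_off_closedBall {r : ℝ} (hr : 0 < r) :
    ∃ (χ : Plane → ℝ) (ε : ℝ) (T : Plane ≃ₜ Plane), IsConicalDiffeo T ∧
      (∀ p, T p = (1 + χ p * cosArg p) • p) ∧ (∀ᶠ p in 𝓝 0, χ p = ε) ∧ 0 < ε ∧ ε < 1 ∧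
      ∀ p ∉ Metric.closedBall 0 r, T p = p := by
  let B : ContDiffBump (0 : Plane) := ⟨r / 2, r, by positivity, by linarith⟩
  have hB : ContDiff ℝ 1 B := B.contDiff
  obtain ⟨b, hb⟩ := exists_bound_fderiv_apply_self_of_hasCompactSupport B.hasCompactSupport hB
  have hb0 : 0 ≤ b := (abs_nonneg _).trans (hb 0)
  obtain ⟨ε, hε, hεb⟩ : ∃ ε : ℝ, 0 < ε ∧ ε * (1 + b) < 1 :=
    ⟨(2 + b)⁻¹, by positivity, by
      rw [inv_mul_lt_one₀ (by positivity)]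
      linarith⟩
  have hε1 : ε < 1 := by nlinarith
  have hχ_le (p : Plane) : |ε * B p| ≤ ε := by
    rw [abs_of_nonneg (mul_nonneg hε.le B.nonneg)]
    exact mul_le_of_le_one_right hε.le B.le_one
  have hχ' (p : Plane) : |ε * B p + fderiv ℝ (fun p => ε * B p) p p| < 1 := by
    have : |B p + fderiv ℝ B p p| ≤ 1 + b :=
      (abs_add_le _ _).trans (add_le_add ((abs_of_nonneg B.nonneg).trans_le B.le_one) (hb p))
    rw [fderiv_const_mul (hB.differentiable one_ne_zero p), smul_apply, smul_eq_mul,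
      ← mul_add, abs_mul, abs_of_pos hε]
    exact (mul_le_mul_of_nonneg_left this hε.le).trans_lt hεb
  have hχ₀ : ∀ᶠ p in 𝓝 0, ε * B p = ε := B.eventuallyEq_one.mono fun p hp => by simp [hp]
  obtain ⟨T, hT, hTχ⟩ := isDirectional_cosArg.exists_isConicalDiffeo abs_cosArg_le_one
    (fun _ => contDiffAt_cosArg) (contDiff_const.mul hB) hε1 hχ_le hχ' hχ₀
  refine ⟨_, ε, T, hT, hTχ, hχ₀, hε, hε1, fun p hp => ?_⟩
  have : B p = 0 := B.zero_of_le_dist (not_le.1 (mt Metric.mem_closedBall.2 hp)).le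
  simp [hTχ, this]

end CompactlySupportedExample

section ChartExtension

variable {S : Type*} [TopologicalSpace S] {X : Type*} [TopologicalSpace X]
  {ψ : OpenPartialHomeomorph S X} {F G : X → X} {K : Set X} {x : S}

open Classical in
/-- The self-map of `S` that is `F` in the chart `ψ` and the identity off the domain of `ψ`. -/
noncomputable def chartExtension (ψ : OpenPartialHomeomorph S X) (F : X → X) (x : S) : S :=
  if x ∈ ψ.source then ψ.symm (F (ψ x)) else x

theorem chartExtension_of_mem (hx : x ∈ ψ.source) : chartExtension ψ F x = ψ.symm (F (ψ x)) :=
  if_pos hx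

theorem chartExtension_of_notMem (hx : x ∉ ψ.source) : chartExtension ψ F x = x := if_neg hx

theorem chartExtension_symm_apply {p : X} (hp : p ∈ ψ.target) :
    chartExtension ψ F (ψ.symm p) = ψ.symm (F p) := by
  rw [chartExtension_of_mem (ψ.map_target hp), ψ.right_inv hp]

theorem chartExtension_eventuallyEq_self [T2Space S] (hK : IsCompact K) (hKψ : K ⊆ ψ.target)
    (hF : ∀ p ∉ K, F p = p) (hx : x ∉ ψ.source) : ∀ᶠ y in 𝓝 x, chartExtension ψ F y = y := by
  have hclosed : IsClosed (ψ.symm '' K) :=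
    (hK.image_of_continuousOn (ψ.continuousOn_symm.mono hKψ)).isClosed
  have hxK : x ∉ ψ.symm '' K := by
    rintro ⟨p, hp, rfl⟩
    exact hx (ψ.map_target (hKψ hp))
  filter_upwards [hclosed.isOpen_compl.mem_nhds hxK] with y hy
  by_cases hys : y ∈ ψ.source
  · rw [chartExtension_of_mem hys, hF _ fun h => hy ⟨_, h, ψ.left_inv hys⟩, ψ.left_inv hys]
  · exact chartExtension_of_notMem hys

theorem continuous_chartExtension [T2Space S] (hK : IsCompact K) (hKψ : K ⊆ ψ.target)
    (hF : ∀ p ∉ K, F p = p) (hFc : Continuous F) (hFψ : MapsTo F ψ.target ψ.target) :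
    Continuous (chartExtension ψ F) := by
  refine continuous_iff_continuousAt.2 fun x => ?_
  by_cases hx : x ∈ ψ.source
  · have in_chart : ContinuousOn (fun y => ψ.symm (F (ψ y))) ψ.source :=
      ψ.continuousOn_symm.comp (hFc.comp_continuousOn ψ.continuousOn)
        fun y hy => hFψ (ψ.map_source hy)
    refine (in_chart.continuousAt (ψ.open_source.mem_nhds hx)).congr ?_
    filter_upwards [ψ.open_source.mem_nhds hx] with y hy using (chartExtension_of_mem hy).symm
  · exact continuousAt_id.congr
      ((chartExtension_eventuallyEq_self hK hKψ hF hx).mono fun y hy => hy.symm)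

theorem leftInverse_chartExtension (hFψ : MapsTo F ψ.target ψ.target)
    (hFG : Function.LeftInverse G F) :
    Function.LeftInverse (chartExtension ψ G) (chartExtension ψ F) := by
  intro x
  by_cases hx : x ∈ ψ.source
  · rw [chartExtension_of_mem hx, chartExtension_symm_apply (hFψ (ψ.map_source hx)), hFG,
      ψ.left_inv hx]
  · rw [chartExtension_of_notMem hx, chartExtension_of_notMem hx]

theorem mapsTo_of_eq_self_off {α : Type*} {F : α → α} {K U : Set α} (hKU : K ⊆ U)
    (hinj : Function.Injective F) (hF : ∀ p ∉ K, F p = p) : MapsTo F U U := by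
  intro p hp
  by_contra h
  exact h (by rwa [hinj (hF _ fun hK => h (hKU hK))])

theorem symm_eq_self_off {α : Type*} {T : α ≃ α} {K : Set α} (hT : ∀ p ∉ K, T p = p) :
    ∀ p ∉ K, T.symm p = p :=
  fun p hp => by rw [T.symm_apply_eq, hT p hp]

variable {T : X ≃ₜ X}

/-- The homeomorphism of `S` that is `T` in the chart `ψ` and the identity elsewhere, for `T`
supported in a compact subset of the range of the chart. -/
noncomputable def chartExtensionHomeomorph [T2Space S] (hK : IsCompact K) (hKψ : K ⊆ ψ.target)
    (hT : ∀ p ∉ K, T p = p) : S ≃ₜ S :=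
  have hT' : ∀ p ∉ K, T.symm p = p := symm_eq_self_off (T := T.toEquiv) hT
  have hm := mapsTo_of_eq_self_off hKψ T.injective hT
  have hm' := mapsTo_of_eq_self_off hKψ T.symm.injective hT'
  { toFun := chartExtension ψ T
    invFun := chartExtension ψ T.symm
    left_inv := leftInverse_chartExtension hm T.symm_apply_apply
    right_inv := leftInverse_chartExtension hm' T.apply_symm_apply
    continuous_toFun := continuous_chartExtension hK hKψ hT T.continuous hm
    continuous_invFun := continuous_chartExtension hK hKψ hT' T.symm.continuous hm' }

theorem PullsBackCkSubmanifolds.chartExtension {S : Type*} [TopologicalSpace S] [T2Space S]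
    [ChartedSpace Plane S] {k : ℕ∞} [IsManifold (𝓡 2) (k : WithTop ℕ∞) S]
    {ψ : OpenPartialHomeomorph S Plane} {F : Plane → Plane} {K : Set Plane}
    (hF : PullsBackCkSubmanifolds k F)
    (hψ : ψ ∈ IsManifold.maximalAtlas (𝓡 2) (k : WithTop ℕ∞) S)
    (hK : IsCompact K) (hKψ : K ⊆ ψ.target)
    (hFψ : MapsTo F ψ.target ψ.target) (hFK : ∀ p ∉ K, F p = p) :
    PullsBackCkSubmanifolds k (chartExtension ψ F) := by
  intro C x hxC hC
  by_cases hx : x ∈ ψ.source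
  · have hFx := hFψ (ψ.map_source hx)
    rw [chartExtension_of_mem hx] at hxC hC
    have in_chart := (isCkOneSubmanifoldAt_symm_preimage_iff hψ (ψ.map_target hFx)).2 hC
    rw [ψ.right_inv hFx] at in_chart
    refine (isCkOneSubmanifoldAt_symm_preimage_iff hψ hx).1 ((hF _ _ hxC in_chart).congr ?_)
    filter_upwards [ψ.open_target.mem_nhds (ψ.map_source hx)] with p hp
    simp only [mem_preimage, chartExtension_symm_apply hp]
  · rw [chartExtension_of_notMem hx] at hC
    refine hC.congr ?_
    filter_upwards [chartExtension_eventuallyEq_self hK hKψ hFK hx] with y hy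
    rw [mem_preimage, hy]

end ChartExtension

section Curves

variable {k : ℕ∞}

theorem isCkCurve_parabola : IsCkCurve ⊤ parabola := by
  have parabola_eq_range : parabola = range fun t : ℝ => (!₂[t, t ^ 2] : Plane) := by
    ext p
    refine ⟨fun hp => ⟨p 0, ?_⟩, ?_⟩
    · ext i
      fin_cases i
      exacts [rfl, Eq.symm hp]
    · rintro ⟨t, rfl⟩
      rfl
  let π₀ : Plane →L[ℝ] ℝ := EuclideanSpace.proj 0
  let π₁ : Plane →L[ℝ] ℝ := EuclideanSpace.proj 1
  refine ⟨isClosed_eq π₁.continuous (π₀.continuous.pow 2), ?_, fun q _ => ?_⟩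
  · rw [parabola_eq_range]
    exact isConnected_range (by fun_prop)
  · let g : Plane → ℝ := fun p => π₁ p - π₀ p ^ 2
    have hg : HasFDerivAt g _ q := π₁.hasFDerivAt.fun_sub (π₀.hasFDerivAt.pow 2)
    refine IsLocalDefiningFunction.isCkOneSubmanifoldAt (g := g) (by simp) ⟨fun h0 => ?_, ?_⟩
    · rw [hg.fderiv] at h0
      simpa [π₀, π₁] using congr($h0 (EuclideanSpace.single 1 1))
    · exact .of_forall fun p => ⟨(π₁.contDiff.sub (π₀.contDiff.pow 2)).contDiffAt, sub_eq_zero.symm⟩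

theorem isSimpleClosedCkCurve_sphere (hk : k ≠ 0) (c : Plane) {ρ : ℝ} (hρ : 0 < ρ) :
    IsSimpleClosedCkCurve k (Metric.sphere c ρ) := by
  refine ⟨isCompact_sphere c ρ, Metric.isClosed_sphere,
    isConnected_sphere (by simp [← Module.finrank_eq_rank]) c hρ.le, fun q hq => ?_⟩
  let g : Plane → ℝ := fun p => ‖p - c‖ ^ 2 - ρ ^ 2
  have hg : HasFDerivAt g _ q := ((hasFDerivAt_id q).sub_const c).norm_sq.sub_const (ρ ^ 2)
  refine IsLocalDefiningFunction.isCkOneSubmanifoldAt (g := g) hk ⟨fun h0 => ?_, ?_⟩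
  · rw [hg.fderiv] at h0
    have two_norm_sq : 2 • inner ℝ (q - c) (q - c) = 0 := congr($h0 (q - c))
    rw [real_inner_self_eq_norm_sq, mem_sphere_iff_norm.1 hq] at two_norm_sq
    simp [hρ.ne'] at two_norm_sq
  · refine .of_forall fun p =>
      ⟨(((contDiff_id.sub contDiff_const).norm_sq ℝ).sub contDiff_const).contDiffAt, ?_⟩
    rw [mem_sphere_iff_norm, sub_eq_zero, sq_eq_sq₀ (norm_nonneg _) hρ.le]

theorem IsSimpleClosedCkCurve.image_chart_symm {S : Type*} [TopologicalSpace S] [T2Space S]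
    [ChartedSpace Plane S] [IsManifold (𝓡 2) (k : WithTop ℕ∞) S]
    {ψ : OpenPartialHomeomorph S Plane}
    (hψ : ψ ∈ IsManifold.maximalAtlas (𝓡 2) (k : WithTop ℕ∞) S) {C : Set Plane}
    (hC : IsSimpleClosedCkCurve k C) (hCψ : C ⊆ ψ.target) :
    IsSimpleClosedCkCurve k (ψ.symm '' C) := by
  obtain ⟨compact, -, connected, submanifold⟩ := hC
  have hcont := ψ.continuousOn_symm.mono hCψ
  have himage := compact.image_of_continuousOn hcont
  refine ⟨himage, himage.isClosed, connected.image _ hcont, forall_mem_image.2 fun q hq => ?_⟩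
  exact (isCkOneSubmanifoldAt_symm_image_iff hψ hCψ (hCψ hq)).2 (submanifold q hq)

/-- The circle of radius `ρ` tangent to the horizontal axis at the origin. -/
def tangentCircle (ρ : ℝ) : Set Plane := Metric.sphere (EuclideanSpace.single 1 ρ) ρ

variable {ρ : ℝ}

theorem zero_mem_tangentCircle (hρ : 0 ≤ ρ) : 0 ∈ tangentCircle ρ := by
  simp [tangentCircle, abs_of_nonneg hρ]

theorem tangentCircle_subset_closedBall (hρ : 0 ≤ ρ) :
    tangentCircle ρ ⊆ Metric.closedBall 0 (2 * ρ) :=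
  Metric.sphere_subset_closedBall.trans <| Metric.closedBall_subset_closedBall' <| by
    simp [abs_of_nonneg hρ, two_mul]

theorem scaledParabola_mem_tangentCircle (hρ : 0 ≤ ρ) (t : ℝ) :
    scaledParabola (fun t => 2 * ρ / (1 + t ^ 2)) t ∈ tangentCircle ρ := by
  rw [tangentCircle, mem_sphere_iff_norm, EuclideanSpace.norm_eq, Fin.sum_univ_two,
    Real.sqrt_eq_iff_mul_self_eq (by positivity) hρ]
  simp only [scaledParabola, PiLp.sub_apply, PiLp.smul_apply, Real.norm_eq_abs, sq_abs]
  simp only [Matrix.cons_val_zero, Matrix.cons_val_one, Matrix.cons_val_fin_one, smul_eq_mul,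
    PiLp.single_eq_same, PiLp.single_eq_of_ne, ne_eq, zero_ne_one, not_false_eq_true, sub_zero]
  field_simp
  ring

theorem not_isCkOneSubmanifoldAt_image_tangentCircle {c χ₀ : ℝ} {χ : Plane → ℝ}
    {T : Plane → Plane} (hT : ∀ p, T p = (c + χ p * cosArg p) • p) (hχ : ∀ᶠ p in 𝓝 0, χ p = χ₀)
    (hχ₀ : 0 < χ₀) (hχc : χ₀ < c) (hρ : 0 < ρ) (hk : 2 ≤ k) :
    ¬ IsCkOneSubmanifoldAt k (T '' tangentCircle ρ) 0 := by
  have hcont : Continuous fun t : ℝ => 2 * ρ / (1 + t ^ 2) :=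
    continuous_const.div (by fun_prop) fun t => by positivity
  exact not_isCkOneSubmanifoldAt_image_of_cosArg hT hχ hχ₀ hχc hcont.continuousAt (by positivity)
    (.of_forall (scaledParabola_mem_tangentCircle hρ.le)) hk

theorem not_isCkOneSubmanifoldAt_image_parabola {c χ₀ : ℝ} {χ : Plane → ℝ}
    {T : Plane → Plane} (hT : ∀ p, T p = (c + χ p * cosArg p) • p) (hχ : ∀ᶠ p in 𝓝 0, χ p = χ₀)
    (hχ₀ : 0 < χ₀) (hχc : χ₀ < c) (hk : 2 ≤ k) : ¬ IsCkOneSubmanifoldAt k (T '' parabola) 0 :=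
  not_isCkOneSubmanifoldAt_image_of_cosArg (m := fun _ => 1) hT hχ hχ₀ hχc continuousAt_const
    one_pos (.of_forall fun t => by simp [scaledParabola, parabola]) hk

end Curves

section Surfaces

variable {S : Type*} [TopologicalSpace S] [T2Space S] [ChartedSpace Plane S] {k : ℕ∞}

theorem pullsBack_chartExtensionHomeomorph [IsManifold (𝓡 2) (k : WithTop ℕ∞) S]
    {ψ : OpenPartialHomeomorph S Plane}
    (hψ : ψ ∈ IsManifold.maximalAtlas (𝓡 2) (k : WithTop ℕ∞) S) {T : Plane ≃ₜ Plane}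
    {K : Set Plane} (hK : IsCompact K) (hKψ : K ⊆ ψ.target) (hTK : ∀ p ∉ K, T p = p)
    (hT : PullsBackCkSubmanifolds k T) (hT' : PullsBackCkSubmanifolds k T.symm) :
    PullsBackCkSubmanifolds k (chartExtensionHomeomorph hK hKψ hTK) ∧
      PullsBackCkSubmanifolds k (chartExtensionHomeomorph hK hKψ hTK).symm :=
  have hTK' : ∀ p ∉ K, T.symm p = p := symm_eq_self_off (T := T.toEquiv) hTK
  ⟨hT.chartExtension hψ hK hKψ (mapsTo_of_eq_self_off hKψ T.injective hTK) hTK,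
    hT'.chartExtension hψ hK hKψ (mapsTo_of_eq_self_off hKψ T.symm.injective hTK') hTK'⟩

theorem exists_pullsBack_one_and_not_isCkCurve_image [Nonempty S]
    [IsManifold (𝓡 2) (k : WithTop ℕ∞) S] (hk : 2 ≤ k) :
    ∃ f : S ≃ₜ S, PullsBackCkSubmanifolds 1 f ∧ PullsBackCkSubmanifolds 1 f.symm ∧
      ∃ C, IsSimpleClosedCkCurve k C ∧ ¬ IsCkCurve k (f '' C) := by
  have one_le : ((1 : ℕ∞) : WithTop ℕ∞) ≤ k := mod_cast one_le_two.trans hk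
  have : IsManifold (𝓡 2) ((1 : ℕ∞) : WithTop ℕ∞) S := .of_le one_le
  have hk0 : k ≠ 0 := (two_pos.trans_le hk).ne'
  obtain ⟨ψ, hψ, hx, hψx⟩ := exists_mem_maximalAtlas_apply_eq_zero (E := Plane)
    (n := (k : WithTop ℕ∞)) (Classical.arbitrary S)
  have h0 : 0 ∈ ψ.target := hψx ▸ ψ.map_source hx
  obtain ⟨r, hr, hball⟩ := Metric.nhds_basis_closedBall.mem_iff.1 (ψ.open_target.mem_nhds h0)
  obtain ⟨χ, ε, T, hT, hTχ, hχ, hε, hε1, hTr⟩ := exists_isConicalDiffeo_eq_self_off_closedBall hr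
  have hK := isCompact_closedBall (0 : Plane) r
  have hr2 : 0 < r / 2 := half_pos hr
  have circle_subset : tangentCircle (r / 2) ⊆ ψ.target :=
    (tangentCircle_subset_closedBall hr2.le).trans (by rwa [mul_div_cancel₀ r two_ne_zero])
  obtain ⟨hf, hf'⟩ := pullsBack_chartExtensionHomeomorph
    (IsManifold.maximalAtlas_subset_of_le one_le hψ) hK hball hTr hT.pullsBack hT.symm.pullsBack
  refine ⟨_, hf, hf', ψ.symm '' tangentCircle (r / 2),
    (isSimpleClosedCkCurve_sphere hk0 _ hr2).image_chart_symm hψ circle_subset, fun h => ?_⟩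
  have image_eq : chartExtensionHomeomorph hK hball hTr '' (ψ.symm '' tangentCircle (r / 2)) =
      ψ.symm '' (T '' tangentCircle (r / 2)) := by
    simp only [image_image]
    exact image_congr fun p hp => chartExtension_symm_apply (circle_subset hp)
  have zero_mem : 0 ∈ T '' tangentCircle (r / 2) :=
    ⟨0, zero_mem_tangentCircle hr2.le, hT.map_zero⟩
  have image_subset : T '' tangentCircle (r / 2) ⊆ ψ.target :=
    ((mapsTo_of_eq_self_off hball T.injective hTr).mono_left circle_subset).image_subset
  rw [image_eq] at h
  exact not_isCkOneSubmanifoldAt_image_tangentCircle hTχ hχ hε hε1 hr2 hk <|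
    (isCkOneSubmanifoldAt_symm_image_iff hψ image_subset h0).1
      (h.2.2 _ (mem_image_of_mem ψ.symm zero_mem))

theorem not_homeoCk_one_le [Nonempty S] [IsManifold (𝓡 2) (k : WithTop ℕ∞) S] (hk : 2 ≤ k) :
    ¬ HomeoCk 1 S ≤ HomeoCk k S ∧ ¬ ProperHomeoCk 1 S ≤ ProperHomeoCk k S := by
  obtain ⟨f, hf, hf', C, hC, hfC⟩ := exists_pullsBack_one_and_not_isCkCurve_image (S := S) hk
  exact ⟨fun hle => hfC ((hle (mem_homeoCk_of_pullsBack hf hf')).1 C hC).2,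
    fun hle => hfC ((hle (mem_properHomeoCk_of_pullsBack hf hf')).1 C hC.2)⟩

end Surfaces

theorem exists_homeomorph_mMap :
    ∃ f : Plane ≃ₜ Plane, (∀ p, f p = mMap p) ∧
      PullsBackCkSubmanifolds 1 f ∧ PullsBackCkSubmanifolds 1 f.symm ∧
      ∀ k : ℕ∞, 2 ≤ k → ¬ IsCkCurve k (f '' parabola) ∧
        ∃ C, IsSimpleClosedCkCurve k C ∧ ¬ IsCkCurve k (f '' C) := by
  obtain ⟨f, hf, hfM⟩ := isDirectional_cosArg.exists_isConicalDiffeo (c := 2) (b := 1)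
    abs_cosArg_le_one (fun _ => contDiffAt_cosArg) (χ := fun _ => 1) contDiff_const one_lt_two
    (by simp) (by simp) (.of_forall fun _ => rfl)
  refine ⟨f, fun p => by rw [hfM, mMap_eq_smul], hf.pullsBack, hf.symm.pullsBack,
    fun k hk => ⟨fun h => ?_, tangentCircle 1, ?_, fun h => ?_⟩⟩
  · exact not_isCkOneSubmanifoldAt_image_parabola hfM (.of_forall fun _ => rfl) one_pos one_lt_two
      hk (h.2.2 0 ⟨0, by simp [parabola], hf.map_zero⟩)
  · exact isSimpleClosedCkCurve_sphere (two_pos.trans_le hk).ne' _ one_pos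
  · exact not_isCkOneSubmanifoldAt_image_tangentCircle hfM (.of_forall fun _ => rfl) one_pos
      one_lt_two one_pos hk (h.2.2 0 ⟨0, zero_mem_tangentCircle zero_le_one, hf.map_zero⟩)

theorem mainTheorem6_general :
    (∃ f : Plane ≃ₜ Plane, (∀ p, f p = mMap p) ∧
      (∀ C : Set Plane, IsCkCurve 1 C → IsCkCurve 1 (f '' C) ∧ IsCkCurve 1 (f.symm '' C)) ∧
      f ∈ HomeoCk 1 Plane ∧
      (∀ k : ℕ∞, 2 ≤ k → ¬ IsCkCurve k (f '' parabola)) ∧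
      ∀ k : ℕ∞, 2 ≤ k → f ∉ HomeoCk k Plane) ∧
    IsCkCurve ⊤ parabola ∧
    (∀ t : ℝ, t ≠ 0 → ContDiffAt ℝ ∞ imageParam t ∧ deriv imageParam t ≠ 0) ∧
    Tendsto (signedCurvature imageParam) (𝓝[<] 0) (𝓝 2) ∧
    Tendsto (signedCurvature imageParam) (𝓝[>] 0) (𝓝 (2 / 3)) ∧
    (∀ (S : Type*) [TopologicalSpace S] [T2Space S] [Nonempty S] [ChartedSpace Plane S] (k : ℕ∞)
      [IsManifold (𝓡 2) (k : WithTop ℕ∞) S], 2 ≤ k →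
        ¬ HomeoCk 1 S ≤ HomeoCk k S ∧ ¬ ProperHomeoCk 1 S ≤ ProperHomeoCk k S) := by
  obtain ⟨f, hfM, hf, hf', hfk⟩ := exists_homeomorph_mMap
  refine ⟨⟨f, hfM, fun C hC => ⟨hC.image_homeomorph hf', hC.image_homeomorph hf⟩,
      mem_homeoCk_of_pullsBack hf hf', fun k hk => (hfk k hk).1, fun k hk hfk' => ?_⟩,
    isCkCurve_parabola, fun t ht => ⟨contDiffAt_imageParam ht, deriv_imageParam_ne_zero ht⟩,
    ?_, ?_, fun S _ _ _ _ k _ hk => not_homeoCk_one_le hk⟩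
  · obtain ⟨C, hC, hfC⟩ := (hfk k hk).2
    exact hfC (hfk'.1 C hC).2
  · convert tendsto_signedCurvature_imageParam (σ := -1) (nhdsLT_le_nhdsNE 0) (by simp)
      (eventually_mem_nhdsWithin.mono fun t ht => by simp [sign_neg (mem_Iio.1 ht)]) using 2
    norm_num
  · convert tendsto_signedCurvature_imageParam (σ := 1) (nhdsGT_le_nhdsNE 0) (by simp)
      (eventually_mem_nhdsWithin.mono fun t ht => by simp [sign_pos (mem_Ioi.1 ht)]) using 2
    norm_num

theorem mainTheorem6 :
    -- the map `M` is a homeomorphism of the plane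
    (∃ f : Plane ≃ₜ Plane, (∀ p, f p = mMap p) ∧
      -- `M` and its inverse send `C^1` curves to `C^1` curves
      (∀ C : Set Plane, IsCkCurve 1 C → IsCkCurve 1 (f '' C) ∧ IsCkCurve 1 (f.symm '' C)) ∧
      f ∈ HomeoCk 1 Plane ∧
      -- the image of the parabola is not a `C^k` curve for any `k ≥ 2`
      (∀ k : ℕ∞, 2 ≤ k → ¬ IsCkCurve k (f '' parabola)) ∧
      ∀ k : ℕ∞, 2 ≤ k → f ∉ HomeoCk k Plane) ∧
    -- the parabola is a `C^∞` curve, and the curvature of its image under `M` jumps at the origin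
    IsCkCurve ⊤ parabola ∧
    (∀ t : ℝ, t ≠ 0 → ContDiffAt ℝ ∞ imageParam t ∧ deriv imageParam t ≠ 0) ∧
    Tendsto (signedCurvature imageParam) (𝓝[<] 0) (𝓝 2) ∧
    Tendsto (signedCurvature imageParam) (𝓝[>] 0) (𝓝 (2 / 3)) ∧
    -- on no smooth surface is `Homeo^1` contained in `Homeo^k` with `k ≥ 2`
    (∀ (S : Type*) [TopologicalSpace S] [T2Space S] [Nonempty S]
      [ChartedSpace Plane S] [IsManifold (𝓡 2) ∞ S] (k : ℕ∞), 2 ≤ k →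
        ¬ HomeoCk 1 S ≤ HomeoCk k S ∧ ¬ ProperHomeoCk 1 S ≤ ProperHomeoCk k S) := by
  obtain ⟨plane, parabola_curve, smooth, left, right, surfaces⟩ := mainTheorem6_general
  exact ⟨plane, parabola_curve, smooth, left, right, fun S _ _ _ _ _ k hk =>
    have : IsManifold (𝓡 2) (k : WithTop ℕ∞) S := .of_le (n := ∞) (mod_cast le_top)
    surfaces S k hk⟩
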